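/- Let $N\ge 0$ be fixed, let $A,C\in\mathbb R^{N\times N}$ and $\sigma_v>0$ be fixed, and for every $M\in\mathbb N$ let $G_M\in\mathbb R^{M\times N}$. Consider, for each $M$, the stationary Gaussian dynamic factor model $$x_{t+1}=Ax_t+Cw_{t+1},\qquad y_t=G_Mx_t+v_t,\qquad t\in\mathbb Z,$$ where $(w_t)$ is i.i.d. $\mathcal N(0,I_N)$, $(v_t)$ is i.i.d. $\mathcal N(0,R_M)$ with $R_M=\sigma_v^2I_M$, the sequences $(w_t)$ and $(v_t)$ are independent, and $x_t$ is square integrable with a law that does not depend on $t$. Assume that all eigenvalues of $A$ have modulus less than $1$, that $A$ and $C$ are invertible, that $\operatorname{rank}(G_M)=N$ for all large $M$, and that $G_M^\top G_M$ is of order $M$, i.e. $\|G_M^\top G_M\|=O(M)$ and $\|(G_M^\top G_M)^{-1}\|=O(1/M)$ as $M\to\infty$, where $\|\cdot\|$ is the Frobenius norm. For each $M$, the Riccati equation $$\Sigma=CC^\top+KR_MK^\top+(A-KG_M)\Sigma(A-KG_M)^\top,\qquad K=A\Sigma G_M^\top(G_M\Sigma G_M^\top+R_M)^{-1},$$ has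 exactly one positive semidefinite solution $\Sigma=\Sigma_M$. It is positive definite, and it is the covariance matrix of $x_t-\mathbb E[x_t\mid y_s,\,s<t]$ for every $t$. Let $K=K_M$ be the corresponding gain, put $B_j=B_{j,M}=G_M(A-K_MG_M)^{j-1}K_M$ for $j\ge1$, and let $a_t=y_t-\mathbb E[y_t\mid y_s,\,s<t]$. Then $y_t$ has the infinite-order VAR representation $$y_t=\sum_{j=1}^\infty B_jy_{t-j}+a_t\ \text{ almost surely},\qquad \mathbb E[a_ty_{t-j}^\top]=0\ (j\ge1),\qquad \mathbb E[a_ta_t^\top]=G_M\Sigma_MG_M^\top+R_M ,$$ and, as $M\to\infty$: 1. For every $j\ge2$, $\|B_{j,M}\|\to0$; moreover $\limsup_{M\to\infty}M^{j-1}\|B_{j,M}\|<\infty$. 2. The representation collapses to the first-order VAR $y_t=B_1y_{t-1}+a_t$: for every $t$, $$\mathbb E\,\bigl\|y_t-B_{1,M}y_{t-1}-a_t\bigr\|^2\to0,$$ where $\mathbb E[a_ty_{t-1}^\top]=0$, $\mathbb E[a_ta_t^\top]=G_M\Sigma_MG_M^\top+R_M$, $B_{1,M}=G_MK_M$, and $\operatorname{rank}(B_{1,M})=N$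 for every $M$ with $\operatorname{rank}(G_M)=N$. -/

import Mathlib

open MeasureTheory ProbabilityTheory Filter Topology Asymptotics
-- Throughout, the norm of a matrix is the Frobenius norm.
open scoped Matrix Matrix.Norms.Frobenius

namespace DFM

noncomputable section

/-- The matrix `E[u vᵀ]` of two random vectors. -/
def crossMoment {Ω : Type*} [MeasurableSpace Ω] (P : Measure Ω) {m n : ℕ}
    (u : Ω → EuclideanSpace ℝ (Fin m)) (v : Ω → EuclideanSpace ℝ (Fin n)) :
    Matrix (Fin m) (Fin n) ℝ :=
  Matrix.of fun i k => ∫ ω, u ω i * v ω k ∂P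

/-- The σ-algebra generated by the strict past `y_s`, `s < t`, of a process. -/
abbrev past {Ω : Type*} {m : ℕ} (y : ℤ → Ω → EuclideanSpace ℝ (Fin m)) (t : ℤ) :
    MeasurableSpace Ω :=
  ⨆ s : Set.Iio t, MeasurableSpace.comap (y s) inferInstance

/-- The one-step prediction error `z_t - E[z_t ∣ y_{t-1}, y_{t-2}, …]`. For `z = y` this is the
innovation `a_t` of `y`. -/
def predError {Ω : Type*} [MeasurableSpace Ω] (P : Measure Ω) {m n : ℕ}
    (z : ℤ → Ω → EuclideanSpace ℝ (Fin n)) (y : ℤ → Ω → EuclideanSpace ℝ (Fin m)) (t : ℤ) :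
    Ω → EuclideanSpace ℝ (Fin n) :=
  z t - P[z t | past y t]

/-- All eigenvalues of the real matrix `A`, real or complex, have modulus less than one. -/
def IsStable {N : ℕ} (A : Matrix (Fin N) (Fin N) ℝ) : Prop :=
  ∀ z ∈ spectrum ℂ (A.map (algebraMap ℝ ℂ)), ‖z‖ < 1

/-- The stationary Gaussian dynamic factor model
`x_{t+1} = A x_t + C w_{t+1}`, `y_t = G x_t + v_t`, `t ∈ ℤ`,
with independent Gaussian white noises `w_t ∼ 𝒩(0, I)` and `v_t ∼ 𝒩(0, R)`. -/
structure IsGaussianDFM {Ω : Type*} [MeasurableSpace Ω] (P : Measure Ω) {N M : ℕ}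
    (A C : Matrix (Fin N) (Fin N) ℝ) (G : Matrix (Fin M) (Fin N) ℝ) (R : Matrix (Fin M) (Fin M) ℝ)
    (x w : ℤ → Ω → EuclideanSpace ℝ (Fin N)) (y v : ℤ → Ω → EuclideanSpace ℝ (Fin M)) : Prop where
  measurable_x : ∀ t, Measurable (x t)
  measurable_w : ∀ t, Measurable (w t)
  measurable_y : ∀ t, Measurable (y t)
  measurable_v : ∀ t, Measurable (v t)
  law_w : ∀ t, HasLaw (w t) (multivariateGaussian 0 1) P
  law_v : ∀ t, HasLaw (v t) (multivariateGaussian 0 R) P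
  indep_w : iIndepFun w P
  indep_v : iIndepFun v P
  indep_w_v : IndepFun (fun ω t => w t ω) (fun ω t => v t ω) P
  state_eq : ∀ t, ∀ᵐ ω ∂P, x (t + 1) ω = A.toEuclideanLin (x t ω) + C.toEuclideanLin (w (t + 1) ω)
  obs_eq : ∀ t, ∀ᵐ ω ∂P, y t ω = G.toEuclideanLin (x t ω) + v t ω
  memLp_x : ∀ t, MemLp (x t) 2 P
  stationary_x : ∀ s t, IdentDistrib (x s) (x t) P P

section Filter

variable {N M : ℕ} (A C : Matrix (Fin N) (Fin N) ℝ) (G : Matrix (Fin M) (Fin N) ℝ)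
  (R : Matrix (Fin M) (Fin M) ℝ) (S : Matrix (Fin N) (Fin N) ℝ)

/-- The innovation covariance `G Σ Gᵀ + R`. -/
def innovCov : Matrix (Fin M) (Fin M) ℝ :=
  G * S * Gᵀ + R

/-- The Kalman gain `K = A Σ Gᵀ (G Σ Gᵀ + R)⁻¹`. -/
def kalmanGain : Matrix (Fin N) (Fin M) ℝ :=
  A * S * Gᵀ * (innovCov G R S)⁻¹

/-- The Riccati equation `Σ = C Cᵀ + K R Kᵀ + (A - K G) Σ (A - K G)ᵀ`. -/
def Riccati : Prop :=
  S = C * Cᵀ + kalmanGain A G R S * R * (kalmanGain A G R S)ᵀ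
    + (A - kalmanGain A G R S * G) * S * (A - kalmanGain A G R S * G)ᵀ

/-- The coefficient `B_j = G (A - K G)^(j-1) K` of the infinite-order VAR (meant for `1 ≤ j`). -/
def varCoeff (j : ℕ) : Matrix (Fin M) (Fin M) ℝ :=
  G * (A - kalmanGain A G R S * G) ^ (j - 1) * kalmanGain A G R S

end Filter

end

end DFM

/-! For a positive definite solution `S` of the Riccati equation the closed loop has the information
form `A - K G = A (S⁻¹ + σ⁻² GᵀG)⁻¹ S⁻¹`, and `S ≥ C Cᵀ` bounds `S⁻¹` uniformly in `M`. Hence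
`A - K G = O(1/M)`, while `‖G‖ ‖K‖` stays bounded, which gives the decay of the coefficients `B_j`.
The error of the stationary observer `x̂_t = A x̂_{t-1} + K (y_{t-1} - G x̂_{t-1})` is uncorrelated
with the past of `y`; all variables lie in one Gaussian space, so it is independent of that past and
`x̂_t` is the conditional expectation of `x_t`. What the first-order VAR leaves out is
`G (A - K G) x̂_{t-1}`, and `x̂` is no larger in `L²` than `x`, so its norm is `O(M^{-1/2})`. -/

namespace DFM

open scoped MatrixOrder ComplexOrder NNReal ENNReal

section FrobeniusNorm

variable {m n : Type*} [Fintype m] [Fintype n]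

theorem norm_toEuclideanLin_le [DecidableEq n] {𝕜 : Type*} [RCLike 𝕜] (A : Matrix m n 𝕜)
    (u : EuclideanSpace 𝕜 n) : ‖A.toEuclideanLin u‖ ≤ ‖A‖ * ‖u‖ := by
  have h := Matrix.frobenius_norm_mul A (Matrix.replicateCol Unit u.ofLp)
  rwa [← Matrix.replicateCol_mulVec, Matrix.frobenius_norm_replicateCol,
    Matrix.frobenius_norm_replicateCol] at h

theorem toEuclideanLin_apply_coord {m : Type*} [DecidableEq n] {𝕜 : Type*} [RCLike 𝕜]
    (A : Matrix m n 𝕜) (u : EuclideanSpace 𝕜 n) (i : m) : A.toEuclideanLin u i = ∑ j, A i j * u j :=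
  rfl

theorem frobenius_norm_sq_eq_trace (A : Matrix m n ℝ) : ‖A‖ ^ 2 = (Aᵀ * A).trace := by
  rw [Matrix.frobenius_norm_def, ← Real.sqrt_eq_rpow, Real.sq_sqrt (by positivity),
    Finset.sum_comm]
  simp [Matrix.trace, Matrix.mul_apply, ← sq]

theorem abs_entry_le_frobenius_norm (A : Matrix m n ℝ) (i : m) (j : n) : |A i j| ≤ ‖A‖ := by
  classical
  simpa [Matrix.toLpLin_apply] using (PiLp.norm_apply_le _ i).trans
    (norm_toEuclideanLin_le A (EuclideanSpace.single j (1 : ℝ)))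

theorem frobenius_norm_le_of_abs_entry_le {A : Matrix m n ℝ} {c : ℝ} (hc : 0 ≤ c)
    (h : ∀ i j, |A i j| ≤ c) : ‖A‖ ≤ √(Fintype.card m * Fintype.card n) * c := by
  refine le_of_sq_le_sq ?_ (by positivity)
  calc ‖A‖ ^ 2 = ∑ i, ∑ j, A i j ^ 2 := by
        rw [frobenius_norm_sq_eq_trace, Finset.sum_comm]
        simp [Matrix.trace, Matrix.mul_apply, ← sq]
    _ ≤ ∑ _i : m, ∑ _j : n, c ^ 2 := Finset.sum_le_sum fun i _ => Finset.sum_le_sum fun j _ =>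
        sq_le_sq.2 ((h i j).trans (le_abs_self c))
    _ = (√(Fintype.card m * Fintype.card n) * c) ^ 2 := by
        rw [mul_pow, Real.sq_sqrt (by positivity)]
        simp [mul_assoc]

theorem trace_le_card_mul_norm (A : Matrix n n ℝ) : A.trace ≤ Fintype.card n * ‖A‖ := by
  simpa [Matrix.trace] using Finset.sum_le_card_nsmul Finset.univ (fun i => A i i) ‖A‖
    fun i _ => (le_abs_self _).trans (abs_entry_le_frobenius_norm A i i)

end FrobeniusNorm

section LoewnerOrder

variable {m n : Type*} [Fintype n]

theorem transpose_eq_of_posSemidef {n : Type*} {A : Matrix n n ℝ} (hA : A.PosSemidef) :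
    Aᵀ = A := by
  rw [← Matrix.conjTranspose_eq_transpose_of_trivial, hA.isHermitian.eq]

theorem posSemidef_mul_mul_transpose [Finite m] {A : Matrix n n ℝ} (hA : A.PosSemidef)
    (B : Matrix m n ℝ) :
    (B * A * Bᵀ).PosSemidef := by
  simpa only [Matrix.conjTranspose_eq_transpose_of_trivial] using hA.mul_mul_conjTranspose_same B

theorem frobenius_norm_le_trace {A : Matrix n n ℝ} (hA : A.PosSemidef) : ‖A‖ ≤ A.trace := by
  classical
  obtain ⟨B, rfl⟩ := CStarAlgebra.nonneg_iff_eq_star_mul_self.1 hA.nonneg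
  rw [Matrix.star_eq_conjTranspose, Matrix.conjTranspose_eq_transpose_of_trivial]
  calc ‖Bᵀ * B‖ ≤ ‖Bᵀ‖ * ‖B‖ := Matrix.frobenius_norm_mul _ _
    _ = (Bᵀ * B).trace := by rw [Matrix.frobenius_norm_transpose, ← sq, frobenius_norm_sq_eq_trace]

theorem trace_mono : Monotone (Matrix.trace : Matrix n n ℝ → ℝ) :=
  (Matrix.tracePositiveLinearMap n ℝ ℝ).monotone'

theorem norm_le_card_mul_norm_of_le {A B : Matrix n n ℝ} (hA : A.PosSemidef) (hAB : A ≤ B) :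
    ‖A‖ ≤ Fintype.card n * ‖B‖ :=
  (frobenius_norm_le_trace hA).trans ((trace_mono hAB).trans (trace_le_card_mul_norm B))

-- Both sides say that the block matrix `[[B, 1], [1, A⁻¹]]` is positive semidefinite.
theorem inv_le_inv_of_le [DecidableEq n] {A B : Matrix n n ℝ} (hA : A.PosDef) (hB : B.PosDef)
    (hAB : A ≤ B) : B⁻¹ ≤ A⁻¹ := by
  have := hA.inv.isUnit.invertible
  have := hB.isUnit.invertible
  have h₁ := hB.fromBlocks₁₁ (1 : Matrix n n ℝ) A⁻¹
  have h₂ := hA.inv.fromBlocks₂₂ B (1 : Matrix n n ℝ)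
  simp only [Matrix.conjTranspose_one, one_mul, mul_one,
    Matrix.nonsing_inv_nonsing_inv A ((Matrix.isUnit_iff_isUnit_det _).1 hA.isUnit)] at h₁ h₂
  exact Matrix.le_iff.2 (h₁.1 (h₂.2 (Matrix.le_iff.1 hAB)))

theorem exists_tendsto_of_monotone_of_le {n : Type*} [Finite n] {Z : ℕ → Matrix n n ℝ}
    {B : Matrix n n ℝ} (hZ : Monotone Z) (hB : ∀ k, Z k ≤ B) : ∃ S, Tendsto Z atTop (𝓝 S) := by
  cases nonempty_fintype n
  have hbdd : BddAbove (Set.range fun k => (Z k).trace) :=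
    ⟨B.trace, by rintro _ ⟨k, rfl⟩; exact trace_mono (hB k)⟩
  have htrace := tendsto_atTop_ciSup (trace_mono.comp hZ) hbdd
  refine cauchySeq_tendsto_of_complete (cauchySeq_of_le_tendsto_0'
    (fun k => (⨆ l, (Z l).trace) - (Z k).trace) (fun k l hkl => ?_) ?_)
  · calc dist (Z k) (Z l) = ‖Z l - Z k‖ := by rw [dist_comm, dist_eq_norm]
      _ ≤ (Z l - Z k).trace := frobenius_norm_le_trace (Matrix.le_iff.1 (hZ hkl))
      _ ≤ (⨆ l, (Z l).trace) - (Z k).trace := by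
        rw [Matrix.trace_sub]
        exact sub_le_sub_right (le_ciSup hbdd l) _
  · simpa using htrace.const_sub (⨆ l, (Z l).trace)

end LoewnerOrder

section Stability

variable {n : ℕ} {A : Matrix (Fin n) (Fin n) ℝ}

theorem summable_norm_pow_of_spectralRadius_lt_one {𝔸 : Type*} [NormedRing 𝔸] [NormedAlgebra ℂ 𝔸]
    [CompleteSpace 𝔸] {a : 𝔸} (ha : spectralRadius ℂ a < 1) : Summable fun k : ℕ => ‖a ^ k‖ := by
  obtain ⟨r, har, hr⟩ := ENNReal.lt_iff_exists_nnreal_btwn.1 ha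
  have hlim := spectrum.pow_nnnorm_pow_one_div_tendsto_nhds_spectralRadius a
  have hpow : ∀ᶠ k : ℕ in atTop, ‖a ^ k‖ ≤ (r : ℝ) ^ k := by
    filter_upwards [hlim.eventually_lt_const har, eventually_gt_atTop 0] with k hk hk0
    rw [one_div, ENNReal.rpow_inv_lt_iff (by positivity), ENNReal.rpow_natCast] at hk
    exact_mod_cast hk.le
  refine Summable.of_norm_bounded_eventually_nat
    (summable_geometric_of_lt_one r.coe_nonneg (by exact_mod_cast hr)) ?_
  simpa only [norm_norm] using hpow

theorem IsStable.summable_norm_pow (hA : IsStable A) : Summable fun k : ℕ => ‖A ^ k‖ := by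
  cases isEmpty_or_nonempty (Fin n)
  · simpa only [Subsingleton.elim (A ^ _) 0, norm_zero] using summable_zero
  have : CompleteSpace (Matrix (Fin n) (Fin n) ℂ) := FiniteDimensional.complete ℂ _
  have hradius : spectralRadius ℂ (A.map (algebraMap ℝ ℂ)) < (1 : NNReal) :=
    spectrum.spectralRadius_lt_of_forall_lt _ fun z hz => by exact_mod_cast hA z hz
  refine (summable_norm_pow_of_spectralRadius_lt_one (by exact_mod_cast hradius)).congr fun k => ?_
  rw [← RingHom.mapMatrix_apply, ← map_pow, RingHom.mapMatrix_apply,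
    Matrix.frobenius_norm_map_eq _ _ fun a => norm_algebraMap' ℂ a]

end Stability

section Lyapunov

variable {n : Type*}

theorem isClosed_setOf_posSemidef [Finite n] : IsClosed {A : Matrix n n ℝ | A.PosSemidef} := by
  cases nonempty_fintype n
  simp only [Matrix.posSemidef_iff_dotProduct_mulVec, Set.ofPred_and, Set.ofPred_forall]
  refine IsClosed.inter (isClosed_eq ?_ continuous_id)
    (isClosed_iInter fun u => isClosed_le continuous_const ?_) <;> fun_prop

theorem conjTranspose_map_ofReal {m n : Type*} (A : Matrix m n ℝ) :
    (A.map (algebraMap ℝ ℂ))ᴴ = Aᵀ.map (algebraMap ℝ ℂ) := by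
  ext i j
  simp

theorem posSemidef_map_ofReal [Finite n] {S : Matrix n n ℝ} (hS : S.PosSemidef) :
    (S.map (algebraMap ℝ ℂ)).PosSemidef := by
  classical
  cases nonempty_fintype n
  obtain ⟨B, rfl⟩ := CStarAlgebra.nonneg_iff_eq_star_mul_self.1 hS.nonneg
  rw [Matrix.map_mul, Matrix.star_eq_conjTranspose,
    Matrix.conjTranspose_eq_transpose_of_trivial, ← conjTranspose_map_ofReal]
  exact Matrix.posSemidef_conjTranspose_mul_self _

theorem posDef_map_ofReal [Finite n] {S : Matrix n n ℝ} (hS : S.PosDef) :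
    (S.map (algebraMap ℝ ℂ)).PosDef := by
  classical
  cases nonempty_fintype n
  exact (posSemidef_map_ofReal hS.posSemidef).posDef_iff_isUnit.2
    (hS.isUnit.map (algebraMap ℝ ℂ).mapMatrix)

variable {N : ℕ} {F S Q : Matrix (Fin N) (Fin N) ℝ}

-- If `Fᴴ u = z̄ u` with `u ≠ 0`, the equation gives `(1 - |z|²) uᴴSu = uᴴQu > 0`.
theorem isStable_of_lyapunov (hS : S.PosSemidef) (hQ : Q.PosDef) (h : S = Q + F * S * Fᵀ) :
    IsStable F := by
  intro z hz
  set B := F.map (algebraMap ℝ ℂ)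
  set T := S.map (algebraMap ℝ ℂ)
  have hTeq : T = Q.map (algebraMap ℝ ℂ) + B * T * Bᴴ := by
    rw [conjTranspose_map_ofReal, ← Matrix.map_mul, ← Matrix.map_mul, ← Matrix.map_add, ← h]
    exact map_add _
  have hz' : star z ∈ spectrum ℂ Bᴴ := by
    rw [← Matrix.star_eq_conjTranspose, spectrum.map_star]
    exact Set.star_mem_star.2 hz
  rw [← Matrix.spectrum_toLin', ← Module.End.hasEigenvalue_iff_mem_spectrum] at hz'
  obtain ⟨u, hu⟩ := hz'.exists_hasEigenvector
  have heig : Bᴴ *ᵥ u = star z • u := hu.apply_eq_smul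
  have hquad : star u ⬝ᵥ (B * T * Bᴴ) *ᵥ u = ↑(‖z‖ ^ 2) * (star u ⬝ᵥ T *ᵥ u) := by
    calc star u ⬝ᵥ (B * T * Bᴴ) *ᵥ u = star (Bᴴ *ᵥ u) ⬝ᵥ T *ᵥ (Bᴴ *ᵥ u) := by
          rw [Matrix.star_mulVec, Matrix.conjTranspose_conjTranspose, ← Matrix.dotProduct_mulVec,
            Matrix.mulVec_mulVec, Matrix.mulVec_mulVec, Matrix.mul_assoc]
      _ = z * star z * (star u ⬝ᵥ T *ᵥ u) := by
          rw [heig, Matrix.mulVec_smul, star_smul, star_star, smul_dotProduct, dotProduct_smul,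
            smul_eq_mul, smul_eq_mul, mul_assoc]
      _ = ↑(‖z‖ ^ 2) * (star u ⬝ᵥ T *ᵥ u) := by
          rw [Complex.ofReal_pow, ← Complex.mul_conj', starRingEnd_apply]
  have hsum := congrArg (fun X => (star u ⬝ᵥ X *ᵥ u).re) hTeq
  simp only [Matrix.add_mulVec, dotProduct_add, hquad, Complex.add_re, Complex.re_ofReal_mul]
    at hsum
  have hTu := (Complex.nonneg_iff.1 ((posSemidef_map_ofReal hS).dotProduct_mulVec_nonneg u)).1
  have hQu := (Complex.pos_iff.1 ((posDef_map_ofReal hQ).dotProduct_mulVec_pos hu.2)).1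
  by_contra! hz1
  nlinarith [one_le_pow₀ hz1 (n := 2)]

theorem IsStable.exists_norm_pow_le (hF : IsStable F) : ∃ b, ∀ k, ‖F ^ k‖ ≤ b :=
  ⟨_, fun k => hF.summable_norm_pow.le_tsum k fun _ _ => norm_nonneg _⟩

theorem IsStable.summable_pow_mul_mul (hF : IsStable F) (Q : Matrix (Fin N) (Fin N) ℝ) :
    Summable fun k => F ^ k * Q * (F ^ k)ᵀ := by
  obtain ⟨b, hb⟩ := hF.exists_norm_pow_le
  refine .of_norm_bounded (hF.summable_norm_pow.mul_right (‖Q‖ * b)) fun k => ?_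
  calc ‖F ^ k * Q * (F ^ k)ᵀ‖ ≤ ‖F ^ k * Q‖ * ‖(F ^ k)ᵀ‖ := norm_mul_le _ _
    _ ≤ ‖F ^ k‖ * ‖Q‖ * b := by
      rw [Matrix.frobenius_norm_transpose]
      exact mul_le_mul (norm_mul_le _ _) (hb k) (norm_nonneg _) (by positivity)
    _ = ‖F ^ k‖ * (‖Q‖ * b) := mul_assoc _ _ _

theorem IsStable.exists_lyapunov (hF : IsStable F) (hQ : Q.PosSemidef) :
    ∃ U : Matrix (Fin N) (Fin N) ℝ, U.PosSemidef ∧ U = F * U * Fᵀ + Q := by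
  have hsum := hF.summable_pow_mul_mul Q
  refine ⟨∑' k, F ^ k * Q * (F ^ k)ᵀ, ?_, ?_⟩
  · exact isClosed_setOf_posSemidef.mem_of_tendsto hsum.hasSum <| .of_forall fun s =>
      Matrix.posSemidef_sum s fun k _ => posSemidef_mul_mul_transpose hQ _
  · nth_rw 1 [hsum.tsum_eq_zero_add]
    rw [← hsum.tsum_mul_left, ← (hsum.mul_left F).tsum_mul_right, add_comm]
    simp only [pow_succ', pow_zero, Matrix.transpose_mul, Matrix.mul_assoc, Matrix.transpose_one,
      Matrix.mul_one, Matrix.one_mul]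

theorem eq_zero_of_bounded_of_eq_mul_mul {M : ℕ} {L : Matrix (Fin M) (Fin M) ℝ}
    (hF : IsStable F) {b c : ℝ} (hL : ∀ k, ‖L ^ k‖ ≤ b)
    {D : ℤ → Matrix (Fin N) (Fin M) ℝ} (hD : ∀ s, ‖D s‖ ≤ c)
    {t : ℤ} (h : ∀ s ≤ t, D s = F * D (s - 1) * Lᵀ) : D t = 0 := by
  have hiter : ∀ k : ℕ, D t = F ^ k * D (t - k) * (L ^ k)ᵀ := by
    intro k
    induction k with
    | zero => simp
    | succ k ih =>
      rw [ih, h (t - k) (by lia), pow_succ, pow_succ, Matrix.transpose_mul]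
      simp only [Matrix.mul_assoc, Nat.cast_succ, sub_sub]
  have hbound : ∀ k : ℕ, ‖D t‖ ≤ ‖F ^ k‖ * (c * b) := by
    intro k
    calc ‖D t‖ = ‖F ^ k * D (t - k) * (L ^ k)ᵀ‖ := congrArg _ (hiter k)
      _ ≤ ‖F ^ k‖ * ‖D (t - k)‖ * ‖L ^ k‖ := by
        rw [← Matrix.frobenius_norm_transpose (L ^ k)]
        exact (Matrix.frobenius_norm_mul _ _).trans
          (mul_le_mul_of_nonneg_right (Matrix.frobenius_norm_mul _ _) (norm_nonneg _))
      _ ≤ ‖F ^ k‖ * (c * b) := by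
        rw [mul_assoc]
        gcongr
        · exact (norm_nonneg _).trans (hD t)
        · exact hD _
        · exact hL k
  have hlim : Tendsto (fun k => ‖F ^ k‖ * (c * b)) atTop (𝓝 0) := by
    simpa using hF.summable_norm_pow.tendsto_atTop_zero.mul_const (c * b)
  exact norm_le_zero_iff.1 (ge_of_tendsto' hlim hbound)

end Lyapunov

section Riccati

variable {N M : ℕ}

/-- The covariance of the estimation error after one step of the observer
`x̂_{t+1} = A x̂_t + K (y_t - G x̂_t)`, if it was `S` before; the Riccati equation says that `S` is
a fixed point for `K` the Kalman gain of `S`. -/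
def gainStep (A C : Matrix (Fin N) (Fin N) ℝ) (G : Matrix (Fin M) (Fin N) ℝ)
    (R : Matrix (Fin M) (Fin M) ℝ) (K : Matrix (Fin N) (Fin M) ℝ) (S : Matrix (Fin N) (Fin N) ℝ) :
    Matrix (Fin N) (Fin N) ℝ :=
  C * Cᵀ + K * R * Kᵀ + (A - K * G) * S * (A - K * G)ᵀ

/-- The map on covariance matrices whose fixed points are the solutions of the Riccati equation. -/
noncomputable def riccatiMap (A C : Matrix (Fin N) (Fin N) ℝ) (G : Matrix (Fin M) (Fin N) ℝ)
    (R : Matrix (Fin M) (Fin M) ℝ) (S : Matrix (Fin N) (Fin N) ℝ) : Matrix (Fin N) (Fin N) ℝ :=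
  gainStep A C G R (kalmanGain A G R S) S

variable (A C : Matrix (Fin N) (Fin N) ℝ) (G : Matrix (Fin M) (Fin N) ℝ)
  {R : Matrix (Fin M) (Fin M) ℝ} {S T : Matrix (Fin N) (Fin N) ℝ}

theorem posDef_innovCov (hR : R.PosDef) (hS : S.PosSemidef) : (innovCov G R S).PosDef :=
  hR.posSemidef_add (posSemidef_mul_mul_transpose hS G)

theorem kalmanGain_mul_innovCov (hR : R.PosDef) (hS : S.PosSemidef) :
    kalmanGain A G R S * innovCov G R S = A * S * Gᵀ := by
  have hdet := (Matrix.isUnit_iff_isUnit_det _).1 (posDef_innovCov G hR hS).isUnit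
  rw [kalmanGain, Matrix.mul_assoc, Matrix.nonsing_inv_mul _ hdet, Matrix.mul_one]

theorem innovCov_mul_transpose_kalmanGain (hR : R.PosDef) (hS : S.PosSemidef) :
    innovCov G R S * (kalmanGain A G R S)ᵀ = G * S * Aᵀ := by
  have h := congrArg Matrix.transpose (kalmanGain_mul_innovCov A G hR hS)
  simpa only [Matrix.transpose_mul, Matrix.transpose_transpose, transpose_eq_of_posSemidef hS,
    transpose_eq_of_posSemidef (posDef_innovCov G hR hS).posSemidef, Matrix.mul_assoc] using h

theorem closedLoop_mul_mul_transpose (hR : R.PosDef) (hS : S.PosSemidef) :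
    (A - kalmanGain A G R S * G) * S * Gᵀ = kalmanGain A G R S * R := by
  have h := kalmanGain_mul_innovCov A G hR hS
  rw [innovCov, Matrix.mul_add] at h
  rw [Matrix.sub_mul, Matrix.sub_mul, ← h]
  simp only [Matrix.mul_assoc]
  abel

theorem gainStep_eq (K : Matrix (Fin N) (Fin M) ℝ) :
    gainStep A C G R K S = C * Cᵀ + A * S * Aᵀ - K * (G * S * Aᵀ) - A * S * Gᵀ * Kᵀ
      + K * innovCov G R S * Kᵀ := by
  rw [gainStep, innovCov]
  simp only [Matrix.transpose_sub, Matrix.transpose_mul, Matrix.sub_mul, Matrix.mul_sub,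
    Matrix.add_mul, Matrix.mul_add, Matrix.mul_assoc]
  abel

-- Completing the square in the gain.
theorem gainStep_eq_riccatiMap_add (hR : R.PosDef) (hS : S.PosSemidef)
    (K : Matrix (Fin N) (Fin M) ℝ) :
    gainStep A C G R K S = riccatiMap A C G R S +
      (K - kalmanGain A G R S) * innovCov G R S * (K - kalmanGain A G R S)ᵀ := by
  rw [riccatiMap, gainStep_eq, gainStep_eq, ← kalmanGain_mul_innovCov A G hR hS,
    ← innovCov_mul_transpose_kalmanGain A G hR hS]
  simp only [Matrix.transpose_sub, Matrix.sub_mul, Matrix.mul_sub, Matrix.mul_assoc]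
  abel

theorem riccatiMap_le_gainStep (hR : R.PosDef) (hS : S.PosSemidef)
    (K : Matrix (Fin N) (Fin M) ℝ) : riccatiMap A C G R S ≤ gainStep A C G R K S := by
  rw [Matrix.le_iff, gainStep_eq_riccatiMap_add A C G hR hS, add_sub_cancel_left]
  exact posSemidef_mul_mul_transpose (posDef_innovCov G hR hS).posSemidef _

theorem posSemidef_riccatiMap (hR : R.PosDef) (hS : S.PosSemidef) :
    (riccatiMap A C G R S).PosSemidef :=
  ((Matrix.posSemidef_self_mul_conjTranspose C).add
    (posSemidef_mul_mul_transpose hR.posSemidef _)).add (posSemidef_mul_mul_transpose hS _)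

theorem gainStep_mono (K : Matrix (Fin N) (Fin M) ℝ) (hST : S ≤ T) :
    gainStep A C G R K S ≤ gainStep A C G R K T := by
  rw [Matrix.le_iff, gainStep, gainStep, add_sub_add_left_eq_sub, ← Matrix.sub_mul,
    ← Matrix.mul_sub]
  exact posSemidef_mul_mul_transpose (Matrix.le_iff.1 hST) _

theorem riccatiMap_mono (hR : R.PosDef) (hS : S.PosSemidef) (hST : S ≤ T) :
    riccatiMap A C G R S ≤ riccatiMap A C G R T :=
  (riccatiMap_le_gainStep A C G hR hS _).trans (gainStep_mono A C G _ hST)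

theorem continuousAt_riccatiMap (hR : R.PosDef) (hS : S.PosSemidef) :
    ContinuousAt (riccatiMap A C G R) S := by
  have hinv : ContinuousAt (fun T => (innovCov G R T)⁻¹) S := by
    have hcov : Continuous (innovCov G R) := by unfold innovCov; fun_prop
    refine (continuousAt_matrix_inv (innovCov G R S) ?_).comp hcov.continuousAt
    rw [Ring.inverse_eq_inv']
    exact continuousAt_inv₀ (posDef_innovCov G hR hS).det_pos.ne'
  have hstep : Continuous fun p : Matrix (Fin N) (Fin N) ℝ × Matrix (Fin M) (Fin M) ℝ =>
      gainStep A C G R (A * p.1 * Gᵀ * p.2) p.1 := by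
    unfold gainStep; fun_prop
  exact ContinuousAt.comp_of_eq (f := fun T => (T, (innovCov G R T)⁻¹)) hstep.continuousAt
    (continuousAt_id.prodMk hinv) rfl

theorem riccatiMap_iterate_mono_and_le (hR : R.PosDef) {U : Matrix (Fin N) (Fin N) ℝ}
    (hU : U.PosSemidef) (hUeq : U = A * U * Aᵀ + C * Cᵀ) (k : ℕ) :
    ((riccatiMap A C G R)^[k] 0).PosSemidef ∧
      (riccatiMap A C G R)^[k] 0 ≤ (riccatiMap A C G R)^[k + 1] 0 ∧
      (riccatiMap A C G R)^[k] 0 ≤ U := by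
  induction k with
  | zero =>
    exact ⟨.zero, (posSemidef_riccatiMap A C G hR .zero).nonneg, hU.nonneg⟩
  | succ k ih =>
    simp only [Function.iterate_succ_apply'] at ih ⊢
    refine ⟨posSemidef_riccatiMap A C G hR ih.1, riccatiMap_mono A C G hR ih.1 ih.2.1, ?_⟩
    calc riccatiMap A C G R ((riccatiMap A C G R)^[k] 0)
        ≤ gainStep A C G R 0 ((riccatiMap A C G R)^[k] 0) := riccatiMap_le_gainStep A C G hR ih.1 0
      _ ≤ gainStep A C G R 0 U := gainStep_mono A C G 0 ih.2.2
      _ = U := by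
        conv_rhs => rw [hUeq]
        simp [gainStep, add_comm]

theorem exists_riccati {A : Matrix (Fin N) (Fin N) ℝ} (hA : IsStable A) (hR : R.PosDef) :
    ∃ S : Matrix (Fin N) (Fin N) ℝ, S.PosSemidef ∧ Riccati A C G R S := by
  obtain ⟨U, hU, hUeq⟩ := hA.exists_lyapunov (Matrix.posSemidef_self_mul_conjTranspose C)
  have hiter := riccatiMap_iterate_mono_and_le A C G hR hU hUeq
  obtain ⟨S, hlim⟩ := exists_tendsto_of_monotone_of_le
    (monotone_nat_of_le_succ fun k => (hiter k).2.1) fun k => (hiter k).2.2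
  have hS : S.PosSemidef :=
    isClosed_setOf_posSemidef.mem_of_tendsto hlim (.of_forall fun k => (hiter k).1)
  exact ⟨S, hS, (isFixedPt_of_tendsto_iterate hlim (continuousAt_riccatiMap A C G hR hS)).symm⟩

end Riccati

section RiccatiSolution

variable {N M : ℕ} {A C : Matrix (Fin N) (Fin N) ℝ} {G : Matrix (Fin M) (Fin N) ℝ}
  {R : Matrix (Fin M) (Fin M) ℝ} {S S' : Matrix (Fin N) (Fin N) ℝ}

theorem posDef_mul_transpose_of_isUnit (hC : IsUnit C) : (C * Cᵀ).PosDef :=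
  Matrix.PosDef.mul_conjTranspose_self C (Matrix.vecMul_injective_of_isUnit hC)

theorem Riccati.mul_transpose_le (h : Riccati A C G R S) (hR : R.PosDef) (hS : S.PosSemidef) :
    C * Cᵀ ≤ S := by
  rw [h, add_assoc]
  exact le_add_of_nonneg_right ((posSemidef_mul_mul_transpose hR.posSemidef _).add
    (posSemidef_mul_mul_transpose hS _)).nonneg

theorem Riccati.posDef (h : Riccati A C G R S) (hR : R.PosDef) (hC : IsUnit C)
    (hS : S.PosSemidef) : S.PosDef := by
  simpa using (posDef_mul_transpose_of_isUnit hC).add_posSemidef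
    (Matrix.le_iff.1 (h.mul_transpose_le hR hS))

theorem Riccati.isStable_closedLoop (h : Riccati A C G R S) (hR : R.PosDef) (hC : IsUnit C)
    (hS : S.PosSemidef) : IsStable (A - kalmanGain A G R S * G) :=
  isStable_of_lyapunov hS ((posDef_mul_transpose_of_isUnit hC).add_posSemidef
    (posSemidef_mul_mul_transpose hR.posSemidef _)) h

theorem Riccati.eq_closedLoop (h : Riccati A C G R S) (hR : R.PosDef) (hS : S.PosSemidef) :
    S = C * Cᵀ + (A - kalmanGain A G R S * G) * S * Aᵀ := by
  conv_lhs => rw [h, ← closedLoop_mul_mul_transpose A G hR hS]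
  rw [Matrix.transpose_sub, Matrix.transpose_mul, Matrix.mul_sub]
  simp only [Matrix.mul_assoc]
  abel

theorem Riccati.sub_eq (h : Riccati A C G R S) (h' : Riccati A C G R S') (hR : R.PosDef)
    (hS : S.PosSemidef) (hS' : S'.PosSemidef) :
    S - S' = (A - kalmanGain A G R S * G) * (S - S') * (A - kalmanGain A G R S' * G)ᵀ := by
  set K := kalmanGain A G R S
  set K' := kalmanGain A G R S'
  have hF : (A - K * G) * S * Gᵀ = K * R := closedLoop_mul_mul_transpose A G hR hS
  have hF' : G * S' * (A - K' * G)ᵀ = R * K'ᵀ := by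
    have := congrArg Matrix.transpose (closedLoop_mul_mul_transpose A G hR hS')
    simpa only [Matrix.transpose_mul, Matrix.transpose_transpose, Matrix.mul_assoc,
      transpose_eq_of_posSemidef hS', transpose_eq_of_posSemidef hR.posSemidef] using this
  have hSeq : S = C * Cᵀ + (A - K * G) * S * Aᵀ := h.eq_closedLoop hR hS
  have hSeq' : S' = C * Cᵀ + A * S' * (A - K' * G)ᵀ := by
    have := congrArg Matrix.transpose (h'.eq_closedLoop hR hS')
    simpa only [Matrix.transpose_add, Matrix.transpose_mul, Matrix.transpose_transpose,
      Matrix.mul_assoc, transpose_eq_of_posSemidef hS'] using this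
  calc S - S' = (A - K * G) * S * Aᵀ - A * S' * (A - K' * G)ᵀ := by
        conv_lhs => rw [hSeq, hSeq', add_sub_add_left_eq_sub]
    _ = (A - K * G) * S * Aᵀ - (A - K * G) * S * Gᵀ * K'ᵀ
        - (A * S' * (A - K' * G)ᵀ - K * (G * S' * (A - K' * G)ᵀ)) := by
      rw [hF, hF', Matrix.mul_assoc K]
      abel
    _ = (A - K * G) * (S - S') * (A - K' * G)ᵀ := by
      simp only [Matrix.transpose_sub, Matrix.transpose_mul, Matrix.mul_sub, Matrix.sub_mul,
        Matrix.mul_assoc]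
      abel

theorem Riccati.unique (h : Riccati A C G R S) (h' : Riccati A C G R S') (hR : R.PosDef)
    (hC : IsUnit C) (hS : S.PosSemidef) (hS' : S'.PosSemidef) : S = S' := by
  obtain ⟨b, hb⟩ := (h'.isStable_closedLoop hR hC hS').exists_norm_pow_le
  exact sub_eq_zero.1 <| eq_zero_of_bounded_of_eq_mul_mul (h.isStable_closedLoop hR hC hS) hb
    (D := fun _ => S - S') (fun _ => le_rfl) (t := 0) fun _ _ => h.sub_eq h' hR hS hS'

end RiccatiSolution

section Gain

variable {N M : ℕ} {A C : Matrix (Fin N) (Fin N) ℝ} {G : Matrix (Fin M) (Fin N) ℝ}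
  {R : Matrix (Fin M) (Fin M) ℝ} {S : Matrix (Fin N) (Fin N) ℝ}

/-- The covariance of the error in estimating the current state once the current observation is
taken into account, in information form: inverse covariances add up. -/
noncomputable def updatedCov (G : Matrix (Fin M) (Fin N) ℝ) (R : Matrix (Fin M) (Fin M) ℝ)
    (S : Matrix (Fin N) (Fin N) ℝ) : Matrix (Fin N) (Fin N) ℝ :=
  (S⁻¹ + Gᵀ * R⁻¹ * G)⁻¹

theorem posDef_updatedCov (hR : R.PosDef) (hS : S.PosDef) : (updatedCov G R S).PosDef :=
  (hS.inv.add_posSemidef (hR.inv.posSemidef.conjTranspose_mul_mul_same G)).inv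

theorem updatedCov_eq_sub (hR : R.PosDef) (hS : S.PosDef) :
    updatedCov G R S = S - S * Gᵀ * (innovCov G R S)⁻¹ * G * S := by
  have hSS : S⁻¹⁻¹ = S := Matrix.nonsing_inv_nonsing_inv S hS.det_pos.ne'.isUnit
  have hRR : R⁻¹⁻¹ = R := Matrix.nonsing_inv_nonsing_inv R hR.det_pos.ne'.isUnit
  have hV : R⁻¹⁻¹ + G * S⁻¹⁻¹ * Gᵀ = innovCov G R S := by rw [hRR, hSS, add_comm, innovCov]
  rw [updatedCov, Matrix.add_mul_mul_inv_eq_sub _ _ _ _ hS.inv.isUnit hR.inv.isUnit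
    (hV ▸ (posDef_innovCov G hR hS.posSemidef).isUnit), hV, hSS]

theorem closedLoop_eq_updatedCov (hR : R.PosDef) (hS : S.PosDef) :
    A - kalmanGain A G R S * G = A * updatedCov G R S * S⁻¹ := by
  have h : A * updatedCov G R S = (A - kalmanGain A G R S * G) * S := by
    rw [updatedCov_eq_sub hR hS, kalmanGain]
    simp only [Matrix.mul_sub, Matrix.sub_mul, Matrix.mul_assoc]
  rw [h, Matrix.mul_nonsing_inv_cancel_right _ _ hS.det_pos.ne'.isUnit]

theorem kalmanGain_eq_updatedCov (hR : R.PosDef) (hS : S.PosDef) :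
    kalmanGain A G R S = A * updatedCov G R S * (Gᵀ * R⁻¹) := by
  have h := closedLoop_mul_mul_transpose A G hR hS.posSemidef
  rw [closedLoop_eq_updatedCov hR hS,
    Matrix.nonsing_inv_mul_cancel_right _ _ hS.det_pos.ne'.isUnit] at h
  rw [← Matrix.mul_assoc, h, Matrix.mul_nonsing_inv_cancel_right _ _ hR.det_pos.ne'.isUnit]

theorem mulVec_injective_of_rank_eq (hG : G.rank = N) : Function.Injective G.mulVec := by
  rw [Matrix.mulVec_injective_iff, linearIndependent_iff_card_eq_finrank_span, Fintype.card_fin,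
    Set.finrank, ← Matrix.rank_eq_finrank_span_cols, hG]

theorem posDef_transpose_mul_mul (hR : R.PosDef) (hG : G.rank = N) : (Gᵀ * R * G).PosDef :=
  hR.conjTranspose_mul_mul_same (mulVec_injective_of_rank_eq hG)

theorem rank_mul_kalmanGain (hR : R.PosDef) (hS : S.PosDef) (hA : IsUnit A) (hG : G.rank = N) :
    (G * kalmanGain A G R S).rank = N := by
  have hgram : IsUnit (Gᵀ * R⁻¹ * G) := (posDef_transpose_mul_mul hR.inv hG).isUnit
  have hgain : Gᵀ * R⁻¹ * (G * kalmanGain A G R S) * G =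
      Gᵀ * R⁻¹ * G * (A * updatedCov G R S) * (Gᵀ * R⁻¹ * G) := by
    rw [kalmanGain_eq_updatedCov hR hS]
    simp only [Matrix.mul_assoc]
  refine le_antisymm ((Matrix.rank_mul_le_left _ _).trans_eq hG) ?_
  calc N = (Gᵀ * R⁻¹ * (G * kalmanGain A G R S) * G).rank := by
        rw [hgain, Matrix.rank_of_isUnit _
          ((hgram.mul (hA.mul (posDef_updatedCov hR hS).isUnit)).mul hgram), Fintype.card_fin]
    _ ≤ (Gᵀ * R⁻¹ * (G * kalmanGain A G R S)).rank := Matrix.rank_mul_le_left _ _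
    _ ≤ (G * kalmanGain A G R S).rank := Matrix.rank_mul_le_right _ _

theorem norm_updatedCov_le (hR : R.PosDef) (hS : S.PosDef) (hG : G.rank = N) :
    ‖updatedCov G R S‖ ≤ N * ‖(Gᵀ * R⁻¹ * G)⁻¹‖ := by
  have hgram := posDef_transpose_mul_mul hR.inv hG
  simpa only [Fintype.card_fin] using
    norm_le_card_mul_norm_of_le (posDef_updatedCov hR hS).posSemidef <|
      inv_le_inv_of_le hgram (hS.inv.add hgram) (le_add_of_nonneg_left hS.inv.posSemidef.nonneg)

theorem Riccati.norm_inv_le (h : Riccati A C G R S) (hR : R.PosDef) (hC : IsUnit C)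
    (hS : S.PosSemidef) : ‖S⁻¹‖ ≤ N * ‖(C * Cᵀ)⁻¹‖ := by
  have hS' := h.posDef hR hC hS
  simpa only [Fintype.card_fin] using norm_le_card_mul_norm_of_le hS'.inv.posSemidef <|
    inv_le_inv_of_le (posDef_mul_transpose_of_isUnit hC) hS' (h.mul_transpose_le hR hS)

theorem Riccati.norm_closedLoop_le (h : Riccati A C G R S) (hR : R.PosDef) (hC : IsUnit C)
    (hS : S.PosSemidef) (hG : G.rank = N) :
    ‖A - kalmanGain A G R S * G‖ ≤
      N ^ 2 * ‖A‖ * ‖(C * Cᵀ)⁻¹‖ * ‖(Gᵀ * R⁻¹ * G)⁻¹‖ := by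
  have hS' := h.posDef hR hC hS
  calc ‖A - kalmanGain A G R S * G‖ ≤ ‖A‖ * ‖updatedCov G R S‖ * ‖S⁻¹‖ := by
        rw [closedLoop_eq_updatedCov hR hS']
        grw [Matrix.frobenius_norm_mul, Matrix.frobenius_norm_mul]
    _ ≤ ‖A‖ * (N * ‖(Gᵀ * R⁻¹ * G)⁻¹‖) * (N * ‖(C * Cᵀ)⁻¹‖) := by
        grw [norm_updatedCov_le hR hS' hG, h.norm_inv_le hR hC hS]
    _ = _ := by ring

theorem norm_kalmanGain_le (hR : R.PosDef) (hS : S.PosDef) (hG : G.rank = N) :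
    ‖kalmanGain A G R S‖ ≤ N * ‖A‖ * ‖(Gᵀ * R⁻¹ * G)⁻¹‖ * ‖Gᵀ * R⁻¹‖ := by
  calc ‖kalmanGain A G R S‖ ≤ ‖A‖ * ‖updatedCov G R S‖ * ‖Gᵀ * R⁻¹‖ := by
        rw [kalmanGain_eq_updatedCov hR hS]
        grw [Matrix.frobenius_norm_mul, Matrix.frobenius_norm_mul]
    _ ≤ ‖A‖ * (N * ‖(Gᵀ * R⁻¹ * G)⁻¹‖) * ‖Gᵀ * R⁻¹‖ := by
        grw [norm_updatedCov_le hR hS hG]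
    _ = _ := by ring

theorem norm_varCoeff_le {j : ℕ} (hj : 2 ≤ j) :
    ‖varCoeff A G R S j‖ ≤
      ‖G‖ * ‖kalmanGain A G R S‖ * ‖A - kalmanGain A G R S * G‖ ^ (j - 1) := by
  rw [varCoeff]
  grw [Matrix.frobenius_norm_mul, Matrix.frobenius_norm_mul, norm_pow_le' _ (by lia : 0 < j - 1)]
  exact (mul_right_comm _ _ _).le

theorem norm_sq_le_norm_gram (G : Matrix (Fin M) (Fin N) ℝ) : ‖G‖ ^ 2 ≤ N * ‖Gᵀ * G‖ := by
  simpa only [frobenius_norm_sq_eq_trace, Fintype.card_fin] using trace_le_card_mul_norm (Gᵀ * G)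

end Gain

section Scalar

variable {M : ℕ} {a : ℝ}

theorem posDef_smul_one (ha : 0 < a) : (a • (1 : Matrix (Fin M) (Fin M) ℝ)).PosDef :=
  Matrix.PosDef.one.smul ha

theorem inv_smul_one (ha : a ≠ 0) :
    (a • (1 : Matrix (Fin M) (Fin M) ℝ))⁻¹ = a⁻¹ • (1 : Matrix (Fin M) (Fin M) ℝ) :=
  Matrix.inv_eq_left_inv (by simp [smul_smul, ha])

theorem gram_inv_smul_one {N : ℕ} {G : Matrix (Fin M) (Fin N) ℝ} (ha : a ≠ 0) (hG : G.rank = N) :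
    (Gᵀ * (a • (1 : Matrix (Fin M) (Fin M) ℝ))⁻¹ * G)⁻¹ = a • (Gᵀ * G)⁻¹ := by
  have hgram : IsUnit (Gᵀ * G).det := by
    simpa using (posDef_transpose_mul_mul .one hG).det_pos.ne'.isUnit
  have := invertibleOfNonzero (inv_ne_zero ha)
  simp only [inv_smul_one ha, Matrix.mul_smul, Matrix.smul_mul, Matrix.mul_one]
  rw [Matrix.inv_smul _ _ hgram, invOf_eq_inv, inv_inv]

end Scalar

section Asymptotic

variable {N : ℕ} {A C : Matrix (Fin N) (Fin N) ℝ} {G : (M : ℕ) → Matrix (Fin M) (Fin N) ℝ}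
  {a : ℝ} {S : ℕ → Matrix (Fin N) (Fin N) ℝ} (ha : 0 < a) (hS : ∀ M, (S M).PosSemidef)
  (hC : IsUnit C) (hRic : ∀ M, Riccati A C (G M) (a • 1) (S M))
  (hG : ∀ᶠ M in atTop, (G M).rank = N)
  (hG_upper : (fun M : ℕ => ‖(G M)ᵀ * G M‖) =O[atTop] fun M : ℕ => (M : ℝ))
  (hG_lower : (fun M : ℕ => ‖((G M)ᵀ * G M)⁻¹‖) =O[atTop] fun M : ℕ => (M : ℝ)⁻¹)

include ha hS hC hRic hG hG_lower in
theorem isBigO_closedLoop :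
    (fun M => ‖A - kalmanGain A (G M) (a • 1) (S M) * G M‖) =O[atTop] fun M : ℕ => (M : ℝ)⁻¹ := by
  refine IsBigO.trans (IsBigO.of_bound (N ^ 2 * ‖A‖ * ‖(C * Cᵀ)⁻¹‖ * a) ?_) hG_lower
  filter_upwards [hG] with M hM
  have := (hRic M).norm_closedLoop_le (posDef_smul_one ha) hC (hS M) hM
  rwa [gram_inv_smul_one ha.ne' hM, norm_smul, Real.norm_of_nonneg ha.le, ← mul_assoc,
    ← norm_norm ((G M)ᵀ * G M)⁻¹, ← norm_norm (A - _)] at this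

include hG_upper in
theorem isBigO_norm_sq : (fun M => ‖G M‖ ^ 2) =O[atTop] fun M : ℕ => (M : ℝ) :=
  IsBigO.trans (IsBigO.of_bound N (.of_forall fun M => by simpa using norm_sq_le_norm_gram (G M)))
    hG_upper

include ha hS hC hRic hG hG_upper hG_lower in
theorem isBigO_norm_mul_norm_kalmanGain :
    (fun M => ‖G M‖ * ‖kalmanGain A (G M) (a • 1) (S M)‖) =O[atTop] fun _ : ℕ => (1 : ℝ) := by
  have h1 : (fun M : ℕ => ‖G M‖ ^ 2 * ‖((G M)ᵀ * G M)⁻¹‖) =O[atTop] fun _ => (1 : ℝ) := by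
    refine ((isBigO_norm_sq hG_upper).mul hG_lower).trans (EventuallyEq.isBigO ?_)
    filter_upwards [eventually_ne_atTop 0] with M hM
    exact mul_inv_cancel₀ (Nat.cast_ne_zero.2 hM)
  refine IsBigO.trans (IsBigO.of_bound (N * ‖A‖) ?_) h1
  filter_upwards [hG] with M hM
  have hR := posDef_smul_one (M := M) ha
  have hK := norm_kalmanGain_le (A := A) hR ((hRic M).posDef hR hC (hS M)) hM
  rw [gram_inv_smul_one ha.ne' hM, inv_smul_one ha.ne', Matrix.mul_smul, Matrix.mul_one, norm_smul,
    norm_smul, norm_inv, Real.norm_of_nonneg ha.le, Matrix.frobenius_norm_transpose] at hK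
  rw [Real.norm_of_nonneg (by positivity), Real.norm_of_nonneg (by positivity)]
  grw [hK]
  exact le_of_eq (by field_simp)

include ha hS hC hRic hG hG_upper hG_lower in
theorem isBigO_varCoeff {j : ℕ} (hj : 2 ≤ j) :
    (fun M => ‖varCoeff A (G M) (a • 1) (S M) j‖) =O[atTop]
      fun M : ℕ => ((M : ℝ)⁻¹) ^ (j - 1) := by
  have hprod := (isBigO_norm_mul_norm_kalmanGain ha hS hC hRic hG hG_upper hG_lower).mul
    ((isBigO_closedLoop ha hS hC hRic hG hG_lower).pow (j - 1))
  simp only [one_mul] at hprod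
  exact (IsBigO.of_bound' (.of_forall fun M => by
    simpa using norm_varCoeff_le (A := A) hj)).trans hprod

include ha hS hC hRic hG hG_upper hG_lower in
theorem tendsto_varCoeff {j : ℕ} (hj : 2 ≤ j) :
    Tendsto (fun M => ‖varCoeff A (G M) (a • 1) (S M) j‖) atTop (𝓝 0) := by
  refine (isBigO_varCoeff ha hS hC hRic hG hG_upper hG_lower hj).trans_tendsto ?_
  have := (tendsto_inv_atTop_nhds_zero_nat (𝕜 := ℝ)).pow (j - 1)
  rwa [zero_pow (by lia)] at this

include ha hS hC hRic hG hG_upper hG_lower in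
theorem limsup_varCoeff_lt_top {j : ℕ} (hj : 2 ≤ j) :
    limsup (fun M : ℕ => (((M : ℝ) ^ (j - 1) * ‖varCoeff A (G M) (a • 1) (S M) j‖ : ℝ) : EReal))
      atTop < ⊤ := by
  obtain ⟨c, hc⟩ := (isBigO_varCoeff ha hS hC hRic hG hG_upper hG_lower hj).bound
  refine lt_of_le_of_lt (limsup_le_of_le (h := ?_)) (EReal.coe_lt_top c)
  filter_upwards [hc, eventually_gt_atTop 0] with M hM hM0
  have hpos : (0 : ℝ) < (M : ℝ) ^ (j - 1) := by positivity
  rw [norm_norm, inv_pow, norm_inv, Real.norm_of_nonneg hpos.le, ← div_eq_mul_inv,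
    le_div_iff₀ hpos, mul_comm] at hM
  exact EReal.coe_le_coe hM

include ha hS hC hRic hG hG_upper hG_lower in
theorem tendsto_norm_mul_norm_closedLoop :
    Tendsto (fun M => ‖G M‖ * ‖A - kalmanGain A (G M) (a • 1) (S M) * G M‖) atTop (𝓝 0) := by
  have hsq := (isBigO_norm_sq hG_upper).mul
    ((isBigO_closedLoop ha hS hC hRic hG hG_lower).pow 2)
  have hlim : Tendsto (fun M : ℕ => (M : ℝ) * ((M : ℝ)⁻¹) ^ 2) atTop (𝓝 0) := by
    refine (tendsto_inv_atTop_nhds_zero_nat (𝕜 := ℝ)).congr' ?_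
    filter_upwards [eventually_ne_atTop 0] with M hM
    field_simp
  have hsqrt := (hsq.trans_tendsto hlim).sqrt
  simpa only [← mul_pow, Real.sqrt_sq (mul_nonneg (norm_nonneg _) (norm_nonneg _)),
    Real.sqrt_zero] using hsqrt

end Asymptotic

section LpGaussian

variable {Ω : Type*} [MeasurableSpace Ω] {P : Measure Ω}

theorem integral_sq_coeFn_Lp (f : Lp ℝ 2 P) : ∫ ω, f ω ^ 2 ∂P = ‖f‖ ^ 2 := by
  rw [← real_inner_self_eq_norm_sq, L2.inner_def]
  simp [sq]

theorem coeFn_sum_smul {ι : Type*} (X : ι → Lp ℝ 2 P) (s : Finset ι) (c : ι → ℝ) :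
    ⇑(∑ i ∈ s, c i • X i) =ᵐ[P] fun ω => ∑ i ∈ s, c i * X i ω := by
  classical
  induction s using Finset.induction_on with
  | empty => exact Lp.coeFn_zero ℝ 2 P
  | insert i s hi ih =>
    simp only [Finset.sum_insert hi]
    filter_upwards [Lp.coeFn_add (c i • X i) (∑ j ∈ s, c j • X j), Lp.coeFn_smul (c i) (X i), ih]
      with ω hadd hsmul hsum
    rw [hadd, Pi.add_apply, hsmul, hsum, Pi.smul_apply, smul_eq_mul]

theorem map_eq_gaussianReal_of_integral_eq_zero {f : Lp ℝ 2 P} (hf : HasGaussianLaw f P)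
    (hf0 : ∫ ω, f ω ∂P = 0) : P.map f = gaussianReal 0 (‖f‖₊ ^ 2) := by
  rw [hf.map_eq_gaussianReal, hf0, variance_of_integral_eq_zero hf.aemeasurable hf0,
    integral_sq_coeFn_Lp]
  congr 1
  exact Real.toNNReal_pow (norm_nonneg f) 2 |>.trans (by rw [norm_toNNReal])

variable [IsProbabilityMeasure P]

theorem continuous_charFun_map_Lp (t : ℝ) :
    Continuous fun f : Lp ℝ 2 P => charFun (P.map f) t := by
  refine continuous_iff_seqContinuous.2 fun f g hfg => ?_
  have hdist := (tendstoInMeasure_of_tendsto_Lp hfg).tendstoInDistribution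
    fun n => (Lp.aestronglyMeasurable _).aemeasurable
  exact ProbabilityMeasure.tendsto_iff_tendsto_charFun.1 hdist.tendsto t

-- Convergence in `L²` is convergence in law, and it preserves the variance.
theorem isClosed_setOf_map_eq_gaussianReal :
    IsClosed {f : Lp ℝ 2 P | P.map f = gaussianReal 0 (‖f‖₊ ^ 2)} := by
  have hset : {f : Lp ℝ 2 P | P.map f = gaussianReal 0 (‖f‖₊ ^ 2)} =
      ⋂ t : ℝ, {f : Lp ℝ 2 P |
        charFun (P.map f) t = Complex.exp (-((‖f‖ : ℂ) ^ 2 * (t : ℂ) ^ 2 / 2))} := by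
    ext f
    have := Measure.isProbabilityMeasure_map (Lp.aestronglyMeasurable f).aemeasurable
    have hcf (t : ℝ) : charFun (gaussianReal 0 (‖f‖₊ ^ 2)) t =
        Complex.exp (-((‖f‖ : ℂ) ^ 2 * (t : ℂ) ^ 2 / 2)) := by simp [charFun_gaussianReal]
    simp only [Set.mem_ofPred_eq, Set.mem_iInter, ← hcf]
    exact ⟨fun h t => by rw [h], fun h => Measure.ext_of_charFun (funext h)⟩
  rw [hset]
  exact isClosed_iInter fun t => isClosed_eq (continuous_charFun_map_Lp t) (by fun_prop)

end LpGaussian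

section GaussianSpace

variable {Ω : Type*} [MeasurableSpace Ω] {P : Measure Ω}

/-- A Gaussian space: a closed subspace of `L²` that consists of centred Gaussian random variables.
For the members of such a space being uncorrelated means being independent. -/
structure IsGaussianSpace (H : Submodule ℝ (Lp ℝ 2 P)) : Prop where
  isClosed : IsClosed (H : Set (Lp ℝ 2 P))
  map_eq : ∀ f ∈ H, P.map f = gaussianReal 0 (‖f‖₊ ^ 2)

theorem isGaussianSpace_topologicalClosure_span {ι : Type*} {X : ι → Lp ℝ 2 P}
    (hX : IsGaussianProcess (fun i => ⇑(X i)) P) (hX0 : ∀ i, ∫ ω, X i ω ∂P = 0) :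
    IsGaussianSpace (Submodule.span ℝ (Set.range X)).topologicalClosure := by
  have := hX.isProbabilityMeasure
  refine ⟨Submodule.isClosed_topologicalClosure _, fun f hf => ?_⟩
  refine closure_minimal (fun g hg => ?_) isClosed_setOf_map_eq_gaussianReal hf
  obtain ⟨c, rfl⟩ := Finsupp.mem_span_range_iff_exists_finsupp.1 hg
  have hsum := coeFn_sum_smul X c.support c
  refine map_eq_gaussianReal_of_integral_eq_zero (.congr ?_ hsum.symm) ?_
  · have hlin := (hX.hasGaussianLaw c.support).map_fun
      (∑ i : c.support, c i • (ContinuousLinearMap.proj i : (c.support → ℝ) →L[ℝ] ℝ))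
    refine hlin.congr (.of_forall fun ω => ?_)
    simpa using Finset.sum_attach c.support (fun i => c i * X i ω)
  · rw [Finsupp.sum, integral_congr_ae hsum,
      integral_finsetSum _ fun i _ => (hX.hasGaussianLaw_eval i).integrable.const_mul _]
    simp [integral_const_mul, hX0]

theorem exists_isGaussianSpace_of_isGaussianProcess {ι : Type*} {W : ι → Ω → ℝ}
    (hW : IsGaussianProcess W P) (hW0 : ∀ i, ∫ ω, W i ω ∂P = 0) :
    ∃ H : Submodule ℝ (Lp ℝ 2 P), IsGaussianSpace H ∧ ∀ i, ∃ f ∈ H, f =ᵐ[P] W i := by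
  have hmem (i : ι) : MemLp (W i) 2 P := (hW.hasGaussianLaw_eval i).memLp_two
  have hae (i : ι) : (hmem i).toLp =ᵐ[P] W i := (hmem i).coeFn_toLp
  exact ⟨_, isGaussianSpace_topologicalClosure_span (hW.congr fun i => (hae i).symm)
    fun i => (integral_congr_ae (hae i)).trans (hW0 i), fun i => ⟨_,
      Submodule.le_topologicalClosure _ (Submodule.subset_span (Set.mem_range_self i)), hae i⟩⟩

/-- All coordinates of the random vector `u` lie, up to null sets, in the subspace `H` of `L²`. -/
def CoordsMem (H : Submodule ℝ (Lp ℝ 2 P)) {n : ℕ} (u : Ω → EuclideanSpace ℝ (Fin n)) : Prop :=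
  ∀ i, ∃ f ∈ H, f =ᵐ[P] fun ω => u ω i

variable {H : Submodule ℝ (Lp ℝ 2 P)} {m n : ℕ} {a b : Ω → EuclideanSpace ℝ (Fin n)}

theorem CoordsMem.memLp (ha : CoordsMem H a) : MemLp a 2 P := by
  refine MemLp.of_eval_piLp fun i => ?_
  obtain ⟨f, -, hf⟩ := ha i
  exact (memLp_congr_ae hf).1 (Lp.memLp f)

theorem CoordsMem.congr (ha : CoordsMem H a) (h : a =ᵐ[P] b) : CoordsMem H b := fun i => by
  obtain ⟨f, hfH, hf⟩ := ha i
  exact ⟨f, hfH, hf.trans (h.mono fun ω hω => congrArg (fun z => z i) hω)⟩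

theorem CoordsMem.add (ha : CoordsMem H a) (hb : CoordsMem H b) :
    CoordsMem H (fun ω => a ω + b ω) := fun i => by
  obtain ⟨f, hfH, hf⟩ := ha i
  obtain ⟨g, hgH, hg⟩ := hb i
  exact ⟨f + g, add_mem hfH hgH, (Lp.coeFn_add f g).trans (hf.add hg)⟩

theorem CoordsMem.zero : CoordsMem H (fun _ => (0 : EuclideanSpace ℝ (Fin n))) :=
  fun _ => ⟨0, zero_mem _, Lp.coeFn_zero ℝ 2 P⟩

theorem CoordsMem.sum {κ : Type*} {s : Finset κ} {f : κ → Ω → EuclideanSpace ℝ (Fin n)}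
    (hf : ∀ j, CoordsMem H (f j)) : CoordsMem H (fun ω => ∑ j ∈ s, f j ω) := by
  classical
  induction s using Finset.induction_on with
  | empty => simpa only [Finset.sum_empty] using CoordsMem.zero
  | insert j s hj ih => simpa only [Finset.sum_insert hj] using (hf j).add ih

theorem CoordsMem.toEuclideanLin (ha : CoordsMem H a) (A : Matrix (Fin m) (Fin n) ℝ) :
    CoordsMem H (fun ω => A.toEuclideanLin (a ω)) := fun i => by
  choose f hfH hf using ha
  refine ⟨∑ j, A i j • f j, Submodule.sum_mem _ fun j _ => H.smul_mem _ (hfH j), ?_⟩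
  filter_upwards [coeFn_sum_smul f Finset.univ (A i), ae_all_iff.2 hf] with ω hsum hω
  simp only [hsum, hω]
  rfl

theorem CoordsMem.of_tendsto {u : ℕ → Ω → EuclideanSpace ℝ (Fin n)}
    (hH : IsClosed (H : Set (Lp ℝ 2 P))) (hu : ∀ k, CoordsMem H (u k)) (ha : MemLp a 2 P)
    (h : Tendsto (fun k => eLpNorm (u k - a) 2 P) atTop (𝓝 0)) : CoordsMem H a := by
  intro i
  choose f hfH hf using fun k => hu k i
  have hai := ha.eval_piLp i
  refine ⟨hai.toLp, hH.mem_of_tendsto (b := atTop)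
    ((Lp.tendsto_Lp_iff_tendsto_eLpNorm' f hai.toLp).2 ?_) (.of_forall hfH), hai.coeFn_toLp⟩
  refine tendsto_of_tendsto_of_tendsto_of_le_of_le tendsto_const_nhds h (fun _ => zero_le)
    fun k => eLpNorm_mono_ae ?_
  filter_upwards [hf k, hai.coeFn_toLp] with ω hfω haω
  rw [Pi.sub_apply, hfω, haω]
  exact PiLp.norm_apply_le (u k ω - a ω) i

theorem IsGaussianSpace.integral_eq_zero (hH : IsGaussianSpace H) (ha : CoordsMem H a) (i : Fin n) :
    ∫ ω, a ω i ∂P = 0 := by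
  obtain ⟨f, hfH, hf⟩ := ha i
  rw [← integral_congr_ae hf, ← integral_id_gaussianReal (μ := 0) (v := ‖f‖₊ ^ 2),
    ← hH.map_eq f hfH, integral_map (Lp.aestronglyMeasurable f).aemeasurable (by fun_prop)]

theorem IsGaussianSpace.isGaussianProcess (hH : IsGaussianSpace H) {T : Type*} {X : T → Lp ℝ 2 P}
    (hX : ∀ t, X t ∈ H) : IsGaussianProcess (fun t => ⇑(X t)) P := by
  classical
  refine ⟨fun I => ⟨isGaussian_of_isGaussian_map fun L => ?_⟩⟩
  have hmeas : AEMeasurable (fun ω => I.restrict (fun t => X t ω)) P :=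
    aemeasurable_pi_iff.2 fun i => (Lp.aestronglyMeasurable _).aemeasurable
  have hL : L ∘ (fun ω => I.restrict (fun t => X t ω)) =ᵐ[P]
      ⇑(∑ i : I, L (Pi.single i 1) • X i) := by
    filter_upwards [coeFn_sum_smul (fun i : I => X i) Finset.univ fun i => L (Pi.single i 1)]
      with ω hω
    have hrestrict : I.restrict (fun t => X t ω) = ∑ i : I, X i ω • Pi.single i (1 : ℝ) := by
      ext j
      simp [Finset.sum_apply, Pi.single_apply]
    rw [hω, Function.comp_apply, hrestrict, map_sum]
    simp only [map_smul, smul_eq_mul, mul_comm]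
  have hmem : ∑ i : I, L (Pi.single i 1) • X i ∈ H :=
    Submodule.sum_mem _ fun i _ => H.smul_mem _ (hX i)
  rw [AEMeasurable.map_map_of_aemeasurable (by fun_prop) hmeas, Measure.map_congr hL,
    hH.map_eq _ hmem]
  infer_instance

theorem IsGaussianSpace.indepFun_of_crossMoment_eq_zero [IsProbabilityMeasure P]
    (hH : IsGaussianSpace H) {T : Type*} {y : T → Ω → EuclideanSpace ℝ (Fin m)}
    (ha : CoordsMem H a) (hy : ∀ s, CoordsMem H (y s)) (h : ∀ s, crossMoment P a (y s) = 0) :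
    IndepFun a (fun ω s => y s ω) P := by
  choose f hfH hf using fun i => ha i
  choose g hgH hg using fun s => hy s
  have hgauss : IsGaussianProcess
      (Sum.elim (fun i ω => a ω i) (fun (p : T × Fin m) ω => y p.1 ω p.2)) P := by
    refine (hH.isGaussianProcess (X := Sum.elim f fun p => g p.1 p.2) ?_).congr ?_
    · exact Sum.forall.2 ⟨hfH, fun p => hgH p.1 p.2⟩
    · exact Sum.forall.2 ⟨hf, fun p => hg p.1 p.2⟩
  have hcoords := hgauss.indepFun_of_covariance_eq_zero ?_ ?_ fun i p => ?_
  · exact hcoords.comp (φ := WithLp.toLp 2) (ψ := fun z s => WithLp.toLp 2 fun i => z (s, i))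
      (by fun_prop) (by fun_prop)
  · exact fun i => (ha.memLp.eval_piLp i).aemeasurable
  · exact fun p => ((hy p.1).memLp.eval_piLp p.2).aemeasurable
  · rw [covariance_eq_sub (ha.memLp.eval_piLp i) ((hy p.1).memLp.eval_piLp p.2),
      hH.integral_eq_zero ha i, zero_mul, sub_zero]
    exact congrFun (congrFun (h p.1) i) p.2

omit [MeasurableSpace Ω] in
theorem comap_pi_eq_past (y : ℤ → Ω → EuclideanSpace ℝ (Fin m)) (t : ℤ) :
    MeasurableSpace.comap (fun ω (s : Set.Iio t) => y s ω) inferInstance = past y t := by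
  rw [past, MeasurableSpace.pi, MeasurableSpace.comap_iSup]
  simp only [MeasurableSpace.comap_comp]
  rfl

theorem past_le {y : ℤ → Ω → EuclideanSpace ℝ (Fin m)} (hy : ∀ s, Measurable (y s)) (t : ℤ) :
    past y t ≤ ‹MeasurableSpace Ω› :=
  iSup_le fun s => (hy s).comap_le

theorem IsGaussianSpace.condExp_past_eq_zero [IsProbabilityMeasure P] (hH : IsGaussianSpace H)
    {y : ℤ → Ω → EuclideanSpace ℝ (Fin m)} {t : ℤ} (hym : ∀ s, Measurable (y s))
    (ha : CoordsMem H a) (hy : ∀ s, CoordsMem H (y s)) (h : ∀ s < t, crossMoment P a (y s) = 0) :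
    P[a | past y t] =ᵐ[P] 0 := by
  have hae := ha.memLp.aemeasurable.ae_eq_mk
  have hindep : Indep (MeasurableSpace.comap (ha.memLp.aemeasurable.mk a) inferInstance)
      (past y t) P := by
    rw [← comap_pi_eq_past]
    exact (hH.indepFun_of_crossMoment_eq_zero (y := fun (s : Set.Iio t) => y s) ha
      (fun s => hy s) (fun s => h s s.2)).congr hae .rfl
  have hmk := ha.memLp.aemeasurable.measurable_mk
  refine (condExp_congr_ae hae).trans ((condExp_indep_eq hmk.comap_le (past_le hym t)
    (comap_measurable _).stronglyMeasurable hindep).trans (.of_forall fun ω => ?_))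
  rw [← integral_congr_ae hae]
  ext i
  rw [eval_integral_piLp fun i => (ha.memLp.eval_piLp i).integrable (by norm_num),
    hH.integral_eq_zero ha i]
  rfl

end GaussianSpace

section Moments

variable {Ω : Type*} [MeasurableSpace Ω] {P : Measure Ω} {k m n : ℕ}
  {u u' : Ω → EuclideanSpace ℝ (Fin m)} {v v' : Ω → EuclideanSpace ℝ (Fin n)}

theorem memLp_toEuclideanLin (A : Matrix (Fin m) (Fin n) ℝ) (hv : MemLp v 2 P) :
    MemLp (fun ω => A.toEuclideanLin (v ω)) 2 P :=
  (LinearMap.toContinuousLinearMap A.toEuclideanLin).comp_memLp' hv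

theorem eLpNorm_toEuclideanLin_le (A : Matrix (Fin m) (Fin n) ℝ)
    (v : Ω → EuclideanSpace ℝ (Fin n)) :
    eLpNorm (fun ω => A.toEuclideanLin (v ω)) 2 P ≤ ENNReal.ofReal ‖A‖ * eLpNorm v 2 P :=
  eLpNorm_le_mul_eLpNorm_of_ae_le_mul (.of_forall fun ω => norm_toEuclideanLin_le A (v ω)) 2

theorem integrable_mul_coord (hu : MemLp u 2 P) (hv : MemLp v 2 P) (i : Fin m) (l : Fin n) :
    Integrable (fun ω => u ω i * v ω l) P :=
  (hu.eval_piLp i).integrable_mul (hv.eval_piLp l)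

theorem crossMoment_congr (hu : u =ᵐ[P] u') (hv : v =ᵐ[P] v') :
    crossMoment P u v = crossMoment P u' v' := by
  ext i l
  refine integral_congr_ae ?_
  filter_upwards [hu, hv] with ω huω hvω
  rw [huω, hvω]

theorem transpose_crossMoment (u : Ω → EuclideanSpace ℝ (Fin m))
    (v : Ω → EuclideanSpace ℝ (Fin n)) : (crossMoment P u v)ᵀ = crossMoment P v u := by
  ext i l
  simp only [crossMoment, Matrix.transpose_apply, Matrix.of_apply, mul_comm]

theorem crossMoment_eq_zero_comm : crossMoment P u v = 0 ↔ crossMoment P v u = 0 := by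
  rw [← transpose_crossMoment v u, Matrix.transpose_eq_zero]

theorem crossMoment_add_left (hu : MemLp u 2 P) (hu' : MemLp u' 2 P) (hv : MemLp v 2 P) :
    crossMoment P (fun ω => u ω + u' ω) v = crossMoment P u v + crossMoment P u' v := by
  ext i l
  simp only [crossMoment, Matrix.of_apply, Matrix.add_apply, PiLp.add_apply, add_mul]
  exact integral_add (integrable_mul_coord hu hv i l) (integrable_mul_coord hu' hv i l)

theorem crossMoment_add_right (hu : MemLp u 2 P) (hv : MemLp v 2 P) (hv' : MemLp v' 2 P) :
    crossMoment P u (fun ω => v ω + v' ω) = crossMoment P u v + crossMoment P u v' := by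
  rw [← transpose_crossMoment, crossMoment_add_left hv hv' hu, Matrix.transpose_add,
    transpose_crossMoment, transpose_crossMoment]

theorem crossMoment_toEuclideanLin_left (A : Matrix (Fin k) (Fin m) ℝ) (hu : MemLp u 2 P)
    (hv : MemLp v 2 P) :
    crossMoment P (fun ω => A.toEuclideanLin (u ω)) v = A * crossMoment P u v := by
  ext i l
  simp only [crossMoment, Matrix.of_apply, Matrix.mul_apply, toEuclideanLin_apply_coord,
    Finset.sum_mul, mul_assoc]
  rw [integral_finsetSum _ fun j _ => (integrable_mul_coord hu hv j l).const_mul _]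
  simp only [integral_const_mul]

theorem crossMoment_toEuclideanLin_right (A : Matrix (Fin k) (Fin n) ℝ) (hu : MemLp u 2 P)
    (hv : MemLp v 2 P) :
    crossMoment P u (fun ω => A.toEuclideanLin (v ω)) = crossMoment P u v * Aᵀ := by
  rw [← transpose_crossMoment, crossMoment_toEuclideanLin_left A hv hu, Matrix.transpose_mul,
    transpose_crossMoment]

theorem abs_crossMoment_apply_le (hu : MemLp u 2 P) (hv : MemLp v 2 P) (i : Fin m) (l : Fin n) :
    |crossMoment P u v i l| ≤ (eLpNorm u 2 P).toReal * (eLpNorm v 2 P).toReal := by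
  have hui := hu.eval_piLp i
  have hvl := hv.eval_piLp l
  have hinner : crossMoment P u v i l = inner ℝ hvl.toLp hui.toLp := by
    rw [L2.inner_def]
    refine integral_congr_ae ?_
    filter_upwards [hui.coeFn_toLp, hvl.coeFn_toLp] with ω huω hvω
    simp [huω, hvω]
  rw [hinner, mul_comm]
  refine (abs_real_inner_le_norm _ _).trans ?_
  rw [Lp.norm_toLp, Lp.norm_toLp]
  gcongr
  · exact hv.2.ne
  · exact eLpNorm_mono fun ω => PiLp.norm_apply_le (v ω) l
  · exact hu.2.ne
  · exact eLpNorm_mono fun ω => PiLp.norm_apply_le (u ω) i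

theorem norm_crossMoment_le (hu : MemLp u 2 P) (hv : MemLp v 2 P) :
    ‖crossMoment P u v‖ ≤ √(m * n) * ((eLpNorm u 2 P).toReal * (eLpNorm v 2 P).toReal) := by
  simpa using frobenius_norm_le_of_abs_entry_le (by positivity) (abs_crossMoment_apply_le hu hv)

theorem eLpNorm_eq_sqrt_trace_crossMoment (hu : MemLp u 2 P) :
    eLpNorm u 2 P = ENNReal.ofReal √(crossMoment P u u).trace := by
  have htrace : (crossMoment P u u).trace = ∫ ω, ‖u ω‖ ^ 2 ∂P := by
    simp only [EuclideanSpace.norm_sq_eq, Real.norm_eq_abs, sq_abs]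
    rw [integral_finsetSum _ fun i _ => (hu.eval_piLp i).integrable_sq]
    simp [Matrix.trace, crossMoment, sq]
  rw [htrace, hu.eLpNorm_eq_integral_rpow_norm (by norm_num) (by norm_num), Real.sqrt_eq_rpow]
  norm_num

theorem crossMoment_eq_zero_of_indepFun (hu : MemLp u 2 P) (hv : MemLp v 2 P)
    (hi : IndepFun u v P) (hu0 : ∀ i, ∫ ω, u ω i ∂P = 0) : crossMoment P u v = 0 := by
  ext i l
  have hil : IndepFun (fun ω => u ω i) (fun ω => v ω l) P :=
    hi.comp (φ := fun z : EuclideanSpace ℝ (Fin m) => z i)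
      (ψ := fun z : EuclideanSpace ℝ (Fin n) => z l) (by fun_prop) (by fun_prop)
  have hprod := hil.integral_fun_mul_eq_mul_integral (hu.eval_piLp i).1 (hv.eval_piLp l).1
  simp only [crossMoment, Matrix.of_apply, hprod, hu0, zero_mul, Matrix.zero_apply]

end Moments

section L2Bounded

variable {Ω T : Type*} [MeasurableSpace Ω] {P : Measure Ω} {m n : ℕ}

/-- The family `z` of random vectors is bounded in `L²`. -/
structure IsL2Bounded (P : Measure Ω) (z : T → Ω → EuclideanSpace ℝ (Fin n)) : Prop where
  aestronglyMeasurable : ∀ t, AEStronglyMeasurable (z t) P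
  exists_eLpNorm_le : ∃ c : ℝ≥0, ∀ t, eLpNorm (z t) 2 P ≤ c

namespace IsL2Bounded

variable {z z' : T → Ω → EuclideanSpace ℝ (Fin n)}

theorem memLp (hz : IsL2Bounded P z) (t : T) : MemLp (z t) 2 P := by
  obtain ⟨c, hc⟩ := hz.exists_eLpNorm_le
  exact ⟨hz.aestronglyMeasurable t, (hc t).trans_lt ENNReal.coe_lt_top⟩

theorem const {η : Ω → EuclideanSpace ℝ (Fin n)} (hη : MemLp η 2 P) :
    IsL2Bounded P fun _ : T => η :=
  ⟨fun _ => hη.1, (eLpNorm η 2 P).toNNReal, fun _ => (ENNReal.coe_toNNReal hη.2.ne).ge⟩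

theorem of_identDistrib {t₀ : T} (hz : MemLp (z t₀) 2 P)
    (h : ∀ t, IdentDistrib (z t) (z t₀) P P) : IsL2Bounded P z :=
  ⟨fun t => ((h t).symm.memLp_snd hz).1, (eLpNorm (z t₀) 2 P).toNNReal, fun t =>
    ((h t).eLpNorm_eq 2).trans_le (ENNReal.coe_toNNReal hz.2.ne).ge⟩

theorem comp {T' : Type*} (hz : IsL2Bounded P z) (f : T' → T) : IsL2Bounded P fun t => z (f t) := by
  obtain ⟨c, hc⟩ := hz.exists_eLpNorm_le
  exact ⟨fun t => hz.aestronglyMeasurable (f t), c, fun t => hc (f t)⟩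

theorem congr (hz : IsL2Bounded P z) (h : ∀ t, z t =ᵐ[P] z' t) : IsL2Bounded P z' := by
  obtain ⟨c, hc⟩ := hz.exists_eLpNorm_le
  exact ⟨fun t => (hz.aestronglyMeasurable t).congr (h t), c, fun t =>
    (eLpNorm_congr_ae (h t)).symm.trans_le (hc t)⟩

theorem add (hz : IsL2Bounded P z) (hz' : IsL2Bounded P z') :
    IsL2Bounded P fun t ω => z t ω + z' t ω := by
  obtain ⟨c, hc⟩ := hz.exists_eLpNorm_le
  obtain ⟨c', hc'⟩ := hz'.exists_eLpNorm_le
  exact ⟨fun t => (hz.aestronglyMeasurable t).add (hz'.aestronglyMeasurable t), c + c', fun t =>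
    (eLpNorm_add_le (hz.aestronglyMeasurable t) (hz'.aestronglyMeasurable t) one_le_two).trans
      (add_le_add (hc t) (hc' t))⟩

theorem sub (hz : IsL2Bounded P z) (hz' : IsL2Bounded P z') :
    IsL2Bounded P fun t ω => z t ω - z' t ω := by
  obtain ⟨c, hc⟩ := hz.exists_eLpNorm_le
  obtain ⟨c', hc'⟩ := hz'.exists_eLpNorm_le
  exact ⟨fun t => (hz.aestronglyMeasurable t).sub (hz'.aestronglyMeasurable t), c + c', fun t =>
    (eLpNorm_sub_le (hz.aestronglyMeasurable t) (hz'.aestronglyMeasurable t) one_le_two).trans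
      (add_le_add (hc t) (hc' t))⟩

theorem toEuclideanLin (hz : IsL2Bounded P z) (A : Matrix (Fin m) (Fin n) ℝ) :
    IsL2Bounded P fun t ω => A.toEuclideanLin (z t ω) := by
  obtain ⟨c, hc⟩ := hz.exists_eLpNorm_le
  exact ⟨fun t => (memLp_toEuclideanLin A (hz.memLp t)).1, ‖A‖.toNNReal * c, fun t =>
    (eLpNorm_toEuclideanLin_le A (z t)).trans (mul_le_mul_right (hc t) _)⟩

theorem exists_norm_crossMoment_le {u : T → Ω → EuclideanSpace ℝ (Fin m)} (hu : IsL2Bounded P u)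
    (hz : IsL2Bounded P z) : ∃ b : ℝ, ∀ t, ‖crossMoment P (u t) (z t)‖ ≤ b := by
  obtain ⟨c, hc⟩ := hu.exists_eLpNorm_le
  obtain ⟨d, hd⟩ := hz.exists_eLpNorm_le
  refine ⟨√(m * n) * (c * d), fun t => (norm_crossMoment_le (hu.memLp t) (hz.memLp t)).trans ?_⟩
  gcongr
  · exact ENNReal.toReal_mono ENNReal.coe_ne_top (hc t)
  · exact ENNReal.toReal_mono ENNReal.coe_ne_top (hd t)

end IsL2Bounded

end L2Bounded

section Autoregression

variable {Ω : Type*} [MeasurableSpace Ω] {P : Measure Ω} {m n : ℕ}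

/-- The process `z` is an `L²`-bounded solution of the vector autoregression
`z_t = F z_{t-1} + u_t`, `t ∈ ℤ`, with shocks `u`. -/
structure IsBoundedAR (P : Measure Ω) (F : Matrix (Fin n) (Fin n) ℝ)
    (u z : ℤ → Ω → EuclideanSpace ℝ (Fin n)) : Prop where
  bounded : IsL2Bounded P z
  eq : ∀ t, z t =ᵐ[P] fun ω => F.toEuclideanLin (z (t - 1) ω) + u t ω

namespace IsBoundedAR

variable {F : Matrix (Fin n) (Fin n) ℝ} {u z : ℤ → Ω → EuclideanSpace ℝ (Fin n)}

theorem memLp_shock (hz : IsBoundedAR P F u z) (t : ℤ) : MemLp (u t) 2 P := by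
  refine (memLp_congr_ae ?_).1 ((hz.bounded.memLp t).sub
    (memLp_toEuclideanLin F (hz.bounded.memLp (t - 1))))
  filter_upwards [hz.eq t] with ω hω
  rw [Pi.sub_apply, hω, add_sub_cancel_left]

theorem eq_pow_add_sum (hz : IsBoundedAR P F u z) (t : ℤ) (k : ℕ) :
    z t =ᵐ[P] fun ω => (F ^ k).toEuclideanLin (z (t - k) ω) +
      ∑ i ∈ Finset.range k, (F ^ i).toEuclideanLin (u (t - i) ω) := by
  induction k with
  | zero => exact .of_forall fun ω => by simp
  | succ k ih =>
    filter_upwards [ih, hz.eq (t - k)] with ω hk hstep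
    rw [hk, hstep, map_add, ← LinearMap.comp_apply, ← Matrix.toLpLin_mul_same, ← pow_succ,
      Finset.sum_range_succ, Nat.cast_succ, ← sub_sub]
    abel

theorem coordsMem {H : Submodule ℝ (Lp ℝ 2 P)} (hz : IsBoundedAR P F u z) (hF : IsStable F)
    (hH : IsClosed (H : Set (Lp ℝ 2 P))) (hu : ∀ t, CoordsMem H (u t)) (t : ℤ) :
    CoordsMem H (z t) := by
  obtain ⟨c, hc⟩ := hz.bounded.exists_eLpNorm_le
  have hlim : Tendsto (fun k : ℕ => ENNReal.ofReal ‖F ^ k‖ * c) atTop (𝓝 0) := by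
    simpa using ENNReal.Tendsto.mul_const
      (ENNReal.tendsto_ofReal hF.summable_norm_pow.tendsto_atTop_zero) (.inr ENNReal.coe_ne_top)
  refine CoordsMem.of_tendsto hH (fun k => CoordsMem.sum (s := Finset.range k) fun i =>
    (hu (t - i)).toEuclideanLin (F ^ i)) (hz.bounded.memLp t)
    (tendsto_of_tendsto_of_tendsto_of_le_of_le tendsto_const_nhds hlim (fun _ => zero_le)
      fun k => ?_)
  calc _ = eLpNorm (fun ω => (F ^ k).toEuclideanLin (z (t - k) ω)) 2 P := by
        rw [eLpNorm_sub_comm]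
        refine eLpNorm_congr_ae ?_
        filter_upwards [hz.eq_pow_add_sum t k] with ω hω
        rw [Pi.sub_apply, hω, add_sub_cancel_right]
    _ ≤ ENNReal.ofReal ‖F ^ k‖ * c := (eLpNorm_toEuclideanLin_le _ _).trans
        (mul_le_mul_right (hc _) _)

theorem crossMoment_left (hz : IsBoundedAR P F u z) {η : Ω → EuclideanSpace ℝ (Fin m)}
    (hη : MemLp η 2 P) (t : ℤ) :
    crossMoment P (z t) η = F * crossMoment P (z (t - 1)) η + crossMoment P (u t) η := by
  rw [crossMoment_congr (hz.eq t) .rfl,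
    crossMoment_add_left (memLp_toEuclideanLin F (hz.bounded.memLp _)) (hz.memLp_shock t) hη,
    crossMoment_toEuclideanLin_left F (hz.bounded.memLp _) hη]

theorem crossMoment_right (hz : IsBoundedAR P F u z) {η : Ω → EuclideanSpace ℝ (Fin m)}
    (hη : MemLp η 2 P) (t : ℤ) :
    crossMoment P η (z t) = crossMoment P η (z (t - 1)) * Fᵀ + crossMoment P η (u t) := by
  rw [← transpose_crossMoment, hz.crossMoment_left hη, Matrix.transpose_add,
    Matrix.transpose_mul, transpose_crossMoment, transpose_crossMoment]

theorem crossMoment_eq_zero (hz : IsBoundedAR P F u z) (hF : IsStable F)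
    {η : Ω → EuclideanSpace ℝ (Fin m)} (hη : MemLp η 2 P) {t : ℤ}
    (h : ∀ s ≤ t, crossMoment P (u s) η = 0) : crossMoment P (z t) η = 0 := by
  obtain ⟨b, hb⟩ := hz.bounded.exists_norm_crossMoment_le (.const hη)
  refine eq_zero_of_bounded_of_eq_mul_mul (L := 1) (D := fun s => crossMoment P (z s) η) hF
    (fun k => (congrArg norm (one_pow k)).le) hb fun s hs => ?_
  simp only [hz.crossMoment_left hη s, h s hs, add_zero, Matrix.transpose_one, Matrix.mul_one]

theorem crossMoment_eq {L : Matrix (Fin m) (Fin m) ℝ} {u' z' : ℤ → Ω → EuclideanSpace ℝ (Fin m)}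
    {Q S : Matrix (Fin n) (Fin m) ℝ} (hz : IsBoundedAR P F u z) (hz' : IsBoundedAR P L u' z')
    (hF : IsStable F) (hL : IsStable L) (hzu : ∀ s, crossMoment P (z (s - 1)) (u' s) = 0)
    (huz : ∀ s, crossMoment P (u s) (z' (s - 1)) = 0) (hu : ∀ s, crossMoment P (u s) (u' s) = Q)
    (hS : S = F * S * Lᵀ + Q) (t : ℤ) : crossMoment P (z t) (z' t) = S := by
  obtain ⟨b, hb⟩ := hz.bounded.exists_norm_crossMoment_le hz'.bounded
  obtain ⟨l, hl⟩ := hL.exists_norm_pow_le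
  rw [← sub_eq_zero]
  refine eq_zero_of_bounded_of_eq_mul_mul (D := fun s => crossMoment P (z s) (z' s) - S) hF hl
    (fun s => (norm_sub_le _ _).trans (add_le_add_left (hb s) _)) fun s _ => ?_
  rw [hz.crossMoment_left (hz'.bounded.memLp s), hz'.crossMoment_right (hz.bounded.memLp (s - 1)),
    hz'.crossMoment_right (hz.memLp_shock s), hzu, huz, hu, Matrix.mul_sub, Matrix.sub_mul]
  nth_rw 1 [hS]
  simp only [add_zero, Matrix.zero_mul, zero_add, add_sub_add_right_eq_sub, Matrix.mul_assoc]

end IsBoundedAR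

end Autoregression

section StationarySolution

variable {Ω : Type*} {n : ℕ} {F : Matrix (Fin n) (Fin n) ℝ} {u : ℤ → Ω → EuclideanSpace ℝ (Fin n)}

/-- The stationary solution `z_t = ∑ₖ Fᵏ u_{t-k}` of the autoregression `z_t = F z_{t-1} + u_t`. -/
noncomputable def stationarySolution (F : Matrix (Fin n) (Fin n) ℝ)
    (u : ℤ → Ω → EuclideanSpace ℝ (Fin n)) (t : ℤ) (ω : Ω) : EuclideanSpace ℝ (Fin n) :=
  ∑' k : ℕ, (F ^ k).toEuclideanLin (u (t - k) ω)

theorem measurable_stationarySolution {𝓕 : MeasurableSpace Ω} {t : ℤ}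
    (hu : ∀ s ≤ t, Measurable (u s)) : Measurable (stationarySolution F u t) :=
  Measurable.tsum fun k => (LinearMap.continuous_of_finiteDimensional _).measurable.comp
    (hu (t - k) (by lia))

variable [MeasurableSpace Ω] {P : Measure Ω}

theorem exists_tsum_eLpNorm_pow_le (hF : IsStable F) (hu : IsL2Bounded P u) :
    ∃ c : ℝ≥0, ∀ t : ℤ,
      ∑' k : ℕ, eLpNorm (fun ω => (F ^ k).toEuclideanLin (u (t - k) ω)) 2 P ≤ c := by
  obtain ⟨c, hc⟩ := hu.exists_eLpNorm_le
  refine ⟨(∑' k : ℕ, ‖F ^ k‖).toNNReal * c, fun t => ?_⟩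
  rw [ENNReal.coe_mul, ← ENNReal.ofReal,
    ENNReal.ofReal_tsum_of_nonneg (fun k => norm_nonneg _) hF.summable_norm_pow,
    ← ENNReal.tsum_mul_right]
  exact ENNReal.tsum_le_tsum fun k => (eLpNorm_toEuclideanLin_le _ _).trans
    (mul_le_mul_right (hc _) _)

theorem ae_summable_stationarySolution (hF : IsStable F) (hu : IsL2Bounded P u) (t : ℤ) :
    ∀ᵐ ω ∂P, Summable fun k : ℕ => (F ^ k).toEuclideanLin (u (t - k) ω) := by
  obtain ⟨c, hc⟩ := exists_tsum_eLpNorm_pow_le hF hu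
  filter_upwards [summable_norm_of_tsum_eLpNorm_ne_top one_le_two
    (fun k : ℕ => (memLp_toEuclideanLin (F ^ k) (hu.memLp (t - k))).1)
    (ne_top_of_le_ne_top ENNReal.coe_ne_top (hc t))] with ω hω
  exact hω.of_norm

theorem isL2Bounded_stationarySolution (hF : IsStable F) (hu : IsL2Bounded P u) :
    IsL2Bounded P (stationarySolution F u) := by
  obtain ⟨c, hc⟩ := exists_tsum_eLpNorm_pow_le hF hu
  have hmeas (t : ℤ) (k : ℕ) := (memLp_toEuclideanLin (F ^ k) (hu.memLp (t - k))).1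
  have hlim (t : ℤ) : ∀ᵐ ω ∂P, Tendsto (fun l : ℕ => (∑ k ∈ Finset.range l, fun ω =>
      (F ^ k).toEuclideanLin (u (t - k) ω)) ω) atTop (𝓝 (stationarySolution F u t ω)) := by
    filter_upwards [ae_summable_stationarySolution hF hu t] with ω hω
    simpa only [Finset.sum_apply, stationarySolution] using hω.hasSum.tendsto_sum_nat
  refine ⟨fun t => aestronglyMeasurable_of_tendsto_ae atTop
    (fun l => Finset.aestronglyMeasurable_sum _ fun k _ => hmeas t k) (hlim t), c, fun t => ?_⟩
  refine Lp.eLpNorm_le_of_ae_tendsto (.of_forall fun l => ?_)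
    (fun l => Finset.aestronglyMeasurable_sum _ fun k _ => hmeas t k) (hlim t)
  calc _ ≤ ∑ k ∈ Finset.range l, eLpNorm (fun ω => (F ^ k).toEuclideanLin (u (t - k) ω)) 2 P :=
        eLpNorm_sum_le (fun k _ => hmeas t k) one_le_two
    _ ≤ c := (ENNReal.sum_le_tsum _).trans (hc t)

theorem isBoundedAR_stationarySolution (hF : IsStable F) (hu : IsL2Bounded P u) :
    IsBoundedAR P F u (stationarySolution F u) := by
  refine ⟨isL2Bounded_stationarySolution hF hu, fun t => ?_⟩
  filter_upwards [ae_summable_stationarySolution hF hu t,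
    ae_summable_stationarySolution hF hu (t - 1)] with ω hω hω'
  have hshift : F.toEuclideanLin (stationarySolution F u (t - 1) ω) =
      ∑' k : ℕ, F.toEuclideanLin ((F ^ k).toEuclideanLin (u (t - 1 - k) ω)) :=
    (LinearMap.toContinuousLinearMap F.toEuclideanLin).map_tsum hω'
  rw [hshift, stationarySolution, hω.tsum_eq_zero_add, add_comm]
  congr 1
  · refine tsum_congr fun k => ?_
    rw [← LinearMap.comp_apply, ← Matrix.toLpLin_mul_same, ← pow_succ', Nat.cast_succ, sub_sub,
      add_comm (1 : ℤ)]
  · simp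

end StationarySolution

section GaussianVector

variable {Ω : Type*} [MeasurableSpace Ω] {P : Measure Ω} {n : ℕ}
  {u : Ω → EuclideanSpace ℝ (Fin n)} {V : Matrix (Fin n) (Fin n) ℝ}

theorem memLp_of_hasLaw_multivariateGaussian (hu : HasLaw u (multivariateGaussian 0 V) P) :
    MemLp u 2 P :=
  hu.hasGaussianLaw.memLp_two

theorem integral_coord_of_hasLaw_multivariateGaussian
    (hu : HasLaw u (multivariateGaussian 0 V) P) (i : Fin n) : ∫ ω, u ω i ∂P = 0 := by
  have := hu.hasGaussianLaw.isProbabilityMeasure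
  rw [← eval_integral_piLp fun i =>
    ((memLp_of_hasLaw_multivariateGaussian hu).eval_piLp i).integrable one_le_two,
    hu.integral_eq, integral_id_multivariateGaussian, PiLp.zero_apply]

theorem crossMoment_self_of_hasLaw_multivariateGaussian (hV : V.PosSemidef)
    (hu : HasLaw u (multivariateGaussian 0 V) P) : crossMoment P u u = V := by
  have := hu.hasGaussianLaw.isProbabilityMeasure
  have hu₂ := memLp_of_hasLaw_multivariateGaussian hu
  ext i j
  have hcov := hu.covariance_fun_comp (f := fun z => z i) (g := fun z => z j)
    (by fun_prop) (by fun_prop)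
  rwa [covariance_eval_multivariateGaussian hV, covariance_eq_sub (hu₂.eval_piLp i)
    (hu₂.eval_piLp j), integral_coord_of_hasLaw_multivariateGaussian hu, zero_mul, sub_zero]
    at hcov

theorem isL2Bounded_of_hasLaw_multivariateGaussian {z : ℤ → Ω → EuclideanSpace ℝ (Fin n)}
    (hz : ∀ t, HasLaw (z t) (multivariateGaussian 0 V) P) : IsL2Bounded P z :=
  .of_identDistrib (memLp_of_hasLaw_multivariateGaussian (hz 0)) fun t => (hz t).identDistrib (hz 0)

end GaussianVector

namespace IsGaussianDFM

variable {Ω : Type*} [MeasurableSpace Ω] {P : Measure Ω} {N M : ℕ}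
  {A C : Matrix (Fin N) (Fin N) ℝ} {G : Matrix (Fin M) (Fin N) ℝ} {R : Matrix (Fin M) (Fin M) ℝ}
  {x w : ℤ → Ω → EuclideanSpace ℝ (Fin N)} {y v : ℤ → Ω → EuclideanSpace ℝ (Fin M)}

theorem isProbabilityMeasure (h : IsGaussianDFM P A C G R x w y v) : IsProbabilityMeasure P :=
  (h.law_w 0).hasGaussianLaw.isProbabilityMeasure

theorem isL2Bounded_w (h : IsGaussianDFM P A C G R x w y v) : IsL2Bounded P w :=
  isL2Bounded_of_hasLaw_multivariateGaussian h.law_w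

theorem isL2Bounded_v (h : IsGaussianDFM P A C G R x w y v) : IsL2Bounded P v :=
  isL2Bounded_of_hasLaw_multivariateGaussian h.law_v

theorem isL2Bounded_x (h : IsGaussianDFM P A C G R x w y v) : IsL2Bounded P x :=
  .of_identDistrib (h.memLp_x 0) fun t => h.stationary_x t 0

theorem isL2Bounded_y (h : IsGaussianDFM P A C G R x w y v) : IsL2Bounded P y :=
  ((h.isL2Bounded_x.toEuclideanLin G).add h.isL2Bounded_v).congr fun t =>
    EventuallyEq.symm (h.obs_eq t)

theorem memLp_w (h : IsGaussianDFM P A C G R x w y v) (t : ℤ) : MemLp (w t) 2 P :=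
  h.isL2Bounded_w.memLp t

theorem memLp_v (h : IsGaussianDFM P A C G R x w y v) (t : ℤ) : MemLp (v t) 2 P :=
  h.isL2Bounded_v.memLp t

theorem memLp_y (h : IsGaussianDFM P A C G R x w y v) (t : ℤ) : MemLp (y t) 2 P :=
  h.isL2Bounded_y.memLp t

theorem crossMoment_w_self (h : IsGaussianDFM P A C G R x w y v) (t : ℤ) :
    crossMoment P (w t) (w t) = 1 :=
  crossMoment_self_of_hasLaw_multivariateGaussian .one (h.law_w t)

theorem crossMoment_v_self (h : IsGaussianDFM P A C G R x w y v) (hR : R.PosSemidef) (t : ℤ) :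
    crossMoment P (v t) (v t) = R :=
  crossMoment_self_of_hasLaw_multivariateGaussian hR (h.law_v t)

theorem crossMoment_w_w (h : IsGaussianDFM P A C G R x w y v) {s t : ℤ} (hst : s ≠ t) :
    crossMoment P (w s) (w t) = 0 :=
  crossMoment_eq_zero_of_indepFun (h.memLp_w s) (h.memLp_w t) (h.indep_w.indepFun hst)
    (integral_coord_of_hasLaw_multivariateGaussian (h.law_w s))

theorem crossMoment_v_v (h : IsGaussianDFM P A C G R x w y v) {s t : ℤ} (hst : s ≠ t) :
    crossMoment P (v s) (v t) = 0 :=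
  crossMoment_eq_zero_of_indepFun (h.memLp_v s) (h.memLp_v t) (h.indep_v.indepFun hst)
    (integral_coord_of_hasLaw_multivariateGaussian (h.law_v s))

theorem crossMoment_w_v (h : IsGaussianDFM P A C G R x w y v) (s t : ℤ) :
    crossMoment P (w s) (v t) = 0 :=
  crossMoment_eq_zero_of_indepFun (h.memLp_w s) (h.memLp_v t)
    (h.indep_w_v.comp (measurable_pi_apply s) (measurable_pi_apply t))
    (integral_coord_of_hasLaw_multivariateGaussian (h.law_w s))

theorem isBoundedAR_x (h : IsGaussianDFM P A C G R x w y v) :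
    IsBoundedAR P A (fun t ω => C.toEuclideanLin (w t ω)) x := by
  refine ⟨h.isL2Bounded_x, fun t => ?_⟩
  filter_upwards [h.state_eq (t - 1)] with ω hω
  rwa [sub_add_cancel] at hω

theorem crossMoment_x_w (h : IsGaussianDFM P A C G R x w y v) (hA : IsStable A) {s t : ℤ}
    (hst : s < t) : crossMoment P (x s) (w t) = 0 := by
  refine h.isBoundedAR_x.crossMoment_eq_zero hA (h.memLp_w t) fun r hr => ?_
  rw [crossMoment_toEuclideanLin_left C (h.memLp_w r) (h.memLp_w t),
    h.crossMoment_w_w (hr.trans_lt hst).ne, Matrix.mul_zero]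

theorem crossMoment_x_v (h : IsGaussianDFM P A C G R x w y v) (hA : IsStable A) (s t : ℤ) :
    crossMoment P (x s) (v t) = 0 := by
  refine h.isBoundedAR_x.crossMoment_eq_zero hA (h.memLp_v t) fun r _ => ?_
  rw [crossMoment_toEuclideanLin_left C (h.memLp_w r) (h.memLp_v t), h.crossMoment_w_v,
    Matrix.mul_zero]

theorem crossMoment_x_self (h : IsGaussianDFM P A C G R x w y v) (hA : IsStable A)
    {U : Matrix (Fin N) (Fin N) ℝ} (hU : U = A * U * Aᵀ + C * Cᵀ) (t : ℤ) :
    crossMoment P (x t) (x t) = U := by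
  have hxw (s : ℤ) := h.crossMoment_x_w hA (sub_one_lt s)
  refine h.isBoundedAR_x.crossMoment_eq h.isBoundedAR_x hA hA (fun s => ?_) (fun s => ?_)
    (fun s => ?_) hU t
  · rw [crossMoment_toEuclideanLin_right C (h.memLp_x _) (h.memLp_w s), hxw, Matrix.zero_mul]
  · rw [crossMoment_toEuclideanLin_left C (h.memLp_w s) (h.memLp_x _),
      crossMoment_eq_zero_comm.1 (hxw s), Matrix.mul_zero]
  · rw [crossMoment_toEuclideanLin_left C (h.memLp_w s) (memLp_toEuclideanLin C (h.memLp_w s)),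
      crossMoment_toEuclideanLin_right C (h.memLp_w s) (h.memLp_w s), h.crossMoment_w_self,
      Matrix.one_mul]

theorem crossMoment_y_right (h : IsGaussianDFM P A C G R x w y v) {n : ℕ}
    {η : Ω → EuclideanSpace ℝ (Fin n)} (hη : MemLp η 2 P) (t : ℤ) :
    crossMoment P η (y t) = crossMoment P η (x t) * Gᵀ + crossMoment P η (v t) := by
  rw [crossMoment_congr .rfl (h.obs_eq t),
    crossMoment_add_right hη (memLp_toEuclideanLin G (h.memLp_x t)) (h.memLp_v t),
    crossMoment_toEuclideanLin_right G hη (h.memLp_x t)]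

theorem crossMoment_w_y (h : IsGaussianDFM P A C G R x w y v) (hA : IsStable A) {s t : ℤ}
    (hst : s < t) : crossMoment P (w t) (y s) = 0 := by
  rw [h.crossMoment_y_right (h.memLp_w t), crossMoment_eq_zero_comm.1 (h.crossMoment_x_w hA hst),
    h.crossMoment_w_v, Matrix.zero_mul, add_zero]

theorem crossMoment_v_y (h : IsGaussianDFM P A C G R x w y v) (hA : IsStable A) (s t : ℤ) :
    crossMoment P (v t) (y s) = crossMoment P (v t) (v s) := by
  rw [h.crossMoment_y_right (h.memLp_v t), crossMoment_eq_zero_comm.1 (h.crossMoment_x_v hA s t),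
    Matrix.zero_mul, zero_add]

theorem isGaussianProcess_noise (h : IsGaussianDFM P A C G R x w y v) :
    IsGaussianProcess (Sum.elim (fun (p : ℤ × Fin N) ω => w p.1 ω p.2)
      fun (p : ℤ × Fin M) ω => v p.1 ω p.2) P := by
  classical
  refine ⟨fun I => ?_⟩
  let J : Finset ℤ := I.image (Sum.elim Prod.fst Prod.fst)
  have hJ : ∀ i ∈ I, Sum.elim Prod.fst Prod.fst i ∈ J := fun i hi => Finset.mem_image_of_mem _ hi
  have hw : HasGaussianLaw (fun ω (t : J) => w t ω) P :=
    iIndepFun.hasGaussianLaw (fun t => (h.law_w t).hasGaussianLaw)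
      (h.indep_w.precomp Subtype.val_injective)
  have hv : HasGaussianLaw (fun ω (t : J) => v t ω) P :=
    iIndepFun.hasGaussianLaw (fun t => (h.law_v t).hasGaussianLaw)
      (h.indep_v.precomp Subtype.val_injective)
  have hwv : IndepFun (fun ω (t : J) => w t ω) (fun ω (t : J) => v t ω) P :=
    h.indep_w_v.comp (φ := fun (z : ℤ → EuclideanSpace ℝ (Fin N)) (t : J) => z t)
      (ψ := fun (z : ℤ → EuclideanSpace ℝ (Fin M)) (t : J) => z t) (by fun_prop) (by fun_prop)
  let L : I → ((J → EuclideanSpace ℝ (Fin N)) × (J → EuclideanSpace ℝ (Fin M))) →L[ℝ] ℝ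
    | ⟨Sum.inl p, hp⟩ => EuclideanSpace.proj p.2 ∘L
        ContinuousLinearMap.proj (⟨p.1, hJ _ hp⟩ : J) ∘L ContinuousLinearMap.fst ℝ _ _
    | ⟨Sum.inr p, hp⟩ => EuclideanSpace.proj p.2 ∘L
        ContinuousLinearMap.proj (⟨p.1, hJ _ hp⟩ : J) ∘L ContinuousLinearMap.snd ℝ _ _
  refine ((hwv.hasGaussianLaw hw hv).map_fun (ContinuousLinearMap.pi L)).congr
    (.of_forall fun ω => ?_)
  ext ⟨i, hi⟩
  cases i <;> rfl

theorem exists_isGaussianSpace (h : IsGaussianDFM P A C G R x w y v) (hA : IsStable A) :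
    ∃ H : Submodule ℝ (Lp ℝ 2 P), IsGaussianSpace H ∧ (∀ t, CoordsMem H (w t)) ∧
      (∀ t, CoordsMem H (v t)) ∧ ∀ t, CoordsMem H (y t) := by
  obtain ⟨H, hH, hmem⟩ := exists_isGaussianSpace_of_isGaussianProcess h.isGaussianProcess_noise <|
    Sum.forall.2 ⟨fun p => integral_coord_of_hasLaw_multivariateGaussian (h.law_w p.1) p.2,
      fun p => integral_coord_of_hasLaw_multivariateGaussian (h.law_v p.1) p.2⟩
  have hw (t : ℤ) : CoordsMem H (w t) := fun i => hmem (.inl (t, i))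
  have hv (t : ℤ) : CoordsMem H (v t) := fun i => hmem (.inr (t, i))
  have hx := h.isBoundedAR_x.coordsMem hA hH.isClosed fun t => (hw t).toEuclideanLin C
  exact ⟨H, hH, hw, hv, fun t => (((hx t).toEuclideanLin G).add (hv t)).congr
    (EventuallyEq.symm (h.obs_eq t))⟩

end IsGaussianDFM

section Observer

variable {Ω : Type*} {N M : ℕ}

/-- The stationary state `x̂` of the observer `x̂_t = A x̂_{t-1} + K (y_{t-1} - G x̂_{t-1})` with
gain `K`. For the Kalman gain this is the stationary Kalman filter. -/
noncomputable def observer (A : Matrix (Fin N) (Fin N) ℝ) (G : Matrix (Fin M) (Fin N) ℝ)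
    (K : Matrix (Fin N) (Fin M) ℝ) (y : ℤ → Ω → EuclideanSpace ℝ (Fin M)) :
    ℤ → Ω → EuclideanSpace ℝ (Fin N) :=
  stationarySolution (A - K * G) fun t ω => K.toEuclideanLin (y (t - 1) ω)

/-- The error `x - x̂` of the observer with gain `K`. -/
noncomputable def observerError (A : Matrix (Fin N) (Fin N) ℝ) (G : Matrix (Fin M) (Fin N) ℝ)
    (K : Matrix (Fin N) (Fin M) ℝ) (x : ℤ → Ω → EuclideanSpace ℝ (Fin N))
    (y : ℤ → Ω → EuclideanSpace ℝ (Fin M)) (t : ℤ) (ω : Ω) : EuclideanSpace ℝ (Fin N) :=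
  x t ω - observer A G K y t ω

/-- `K` is the gain and `S` the error covariance of a stationary optimal filter: the error dynamics
are stable, `S` solves the resulting equation for `E[e_t x_tᵀ]`, where `e` is the error of the
observer, and `e_{t+1}` is uncorrelated with `y_t`. -/
structure IsSteadyStateGain (A C : Matrix (Fin N) (Fin N) ℝ) (G : Matrix (Fin M) (Fin N) ℝ)
    (R : Matrix (Fin M) (Fin M) ℝ) (K : Matrix (Fin N) (Fin M) ℝ)
    (S : Matrix (Fin N) (Fin N) ℝ) : Prop where
  isStable : IsStable (A - K * G)
  cov_eq : S = (A - K * G) * S * Aᵀ + C * Cᵀ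
  gain_eq : (A - K * G) * S * Gᵀ = K * R

variable {A C : Matrix (Fin N) (Fin N) ℝ} {G : Matrix (Fin M) (Fin N) ℝ}
  {R : Matrix (Fin M) (Fin M) ℝ} {K : Matrix (Fin N) (Fin M) ℝ} {S : Matrix (Fin N) (Fin N) ℝ}

theorem Riccati.isSteadyStateGain (h : Riccati A C G R S) (hR : R.PosDef) (hC : IsUnit C)
    (hS : S.PosSemidef) : IsSteadyStateGain A C G R (kalmanGain A G R S) S where
  isStable := h.isStable_closedLoop hR hC hS
  cov_eq := by
    rw [add_comm]
    exact h.eq_closedLoop hR hS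
  gain_eq := closedLoop_mul_mul_transpose A G hR hS

theorem IsSteadyStateGain.eq_gainStep (hK : IsSteadyStateGain A C G R K S) :
    S = gainStep A C G R K S := by
  rw [gainStep, Matrix.transpose_sub, Matrix.mul_sub, Matrix.transpose_mul,
    ← Matrix.mul_assoc _ Gᵀ Kᵀ, hK.gain_eq, add_assoc, add_sub_cancel, add_comm]
  exact hK.cov_eq

theorem measurable_observer_past (y : ℤ → Ω → EuclideanSpace ℝ (Fin M)) (t : ℤ) :
    Measurable[past y t] (observer A G K y t) := by
  refine measurable_stationarySolution (𝓕 := past y t) fun s hs => ?_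
  have hy : Measurable[past y t] (y (s - 1)) := (comap_measurable (y (s - 1))).mono
    (le_iSup (fun r : Set.Iio t => MeasurableSpace.comap (y r) inferInstance) ⟨s - 1, by grind⟩)
    le_rfl
  exact (LinearMap.continuous_of_finiteDimensional _).measurable.comp hy

end Observer

namespace IsGaussianDFM

variable {Ω : Type*} [MeasurableSpace Ω] {P : Measure Ω} {N M : ℕ}
  {A C : Matrix (Fin N) (Fin N) ℝ} {G : Matrix (Fin M) (Fin N) ℝ} {R : Matrix (Fin M) (Fin M) ℝ}
  {K : Matrix (Fin N) (Fin M) ℝ} {S : Matrix (Fin N) (Fin N) ℝ}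
  {x w : ℤ → Ω → EuclideanSpace ℝ (Fin N)} {y v : ℤ → Ω → EuclideanSpace ℝ (Fin M)}

theorem isBoundedAR_observer (h : IsGaussianDFM P A C G R x w y v) (hF : IsStable (A - K * G)) :
    IsBoundedAR P (A - K * G) (fun t ω => K.toEuclideanLin (y (t - 1) ω)) (observer A G K y) :=
  isBoundedAR_stationarySolution hF ((h.isL2Bounded_y.comp fun t => t - 1).toEuclideanLin K)

theorem isBoundedAR_observerError (h : IsGaussianDFM P A C G R x w y v)
    (hF : IsStable (A - K * G)) :
    IsBoundedAR P (A - K * G)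
      (fun t ω => C.toEuclideanLin (w t ω) + (-K).toEuclideanLin (v (t - 1) ω))
      (observerError A G K x y) := by
  refine ⟨h.isL2Bounded_x.sub (h.isBoundedAR_observer hF).bounded, fun t => ?_⟩
  filter_upwards [h.isBoundedAR_x.eq t, (h.isBoundedAR_observer hF).eq t, h.obs_eq (t - 1)]
    with ω hx hobs hy
  rw [observerError, hx, hobs, hy, observerError]
  simp only [map_add, map_sub, map_neg, LinearMap.sub_apply, LinearMap.neg_apply,
    Matrix.toLpLin_mul_same, LinearMap.comp_apply]
  abel

theorem memLp_observerError (h : IsGaussianDFM P A C G R x w y v) (hF : IsStable (A - K * G))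
    (t : ℤ) : MemLp (observerError A G K x y t) 2 P :=
  (h.isBoundedAR_observerError hF).bounded.memLp t

theorem crossMoment_observerShock (h : IsGaussianDFM P A C G R x w y v) {n : ℕ}
    {η : Ω → EuclideanSpace ℝ (Fin n)} (hη : MemLp η 2 P) (t : ℤ) :
    crossMoment P (fun ω => C.toEuclideanLin (w t ω) + (-K).toEuclideanLin (v (t - 1) ω)) η =
      C * crossMoment P (w t) η - K * crossMoment P (v (t - 1)) η := by
  rw [crossMoment_add_left (memLp_toEuclideanLin C (h.memLp_w t))
      (memLp_toEuclideanLin (-K) (h.memLp_v _)) hη,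
    crossMoment_toEuclideanLin_left C (h.memLp_w t) hη,
    crossMoment_toEuclideanLin_left (-K) (h.memLp_v _) hη, Matrix.neg_mul, ← sub_eq_add_neg]

theorem crossMoment_observerError_w (h : IsGaussianDFM P A C G R x w y v)
    (hF : IsStable (A - K * G)) {s t : ℤ} (hst : s < t) :
    crossMoment P (observerError A G K x y s) (w t) = 0 := by
  refine (h.isBoundedAR_observerError hF).crossMoment_eq_zero hF (h.memLp_w t) fun r hr => ?_
  rw [h.crossMoment_observerShock (h.memLp_w t), h.crossMoment_w_w (hr.trans_lt hst).ne,
    crossMoment_eq_zero_comm.1 (h.crossMoment_w_v t (r - 1)), Matrix.mul_zero, Matrix.mul_zero,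
    sub_zero]

theorem crossMoment_observerError_v (h : IsGaussianDFM P A C G R x w y v)
    (hF : IsStable (A - K * G)) {s t : ℤ} (hst : s ≤ t) :
    crossMoment P (observerError A G K x y s) (v t) = 0 := by
  refine (h.isBoundedAR_observerError hF).crossMoment_eq_zero hF (h.memLp_v t) fun r hr => ?_
  rw [h.crossMoment_observerShock (h.memLp_v t), h.crossMoment_w_v, h.crossMoment_v_v (by lia),
    Matrix.mul_zero, Matrix.mul_zero, sub_zero]

theorem crossMoment_observerShock_self (h : IsGaussianDFM P A C G R x w y v)
    (hR : R.PosSemidef) (t : ℤ) :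
    crossMoment P (fun ω => C.toEuclideanLin (w t ω) + (-K).toEuclideanLin (v (t - 1) ω))
      (fun ω => C.toEuclideanLin (w t ω) + (-K).toEuclideanLin (v (t - 1) ω)) =
      C * Cᵀ + K * R * Kᵀ := by
  have hw := h.memLp_w t
  have hv := h.memLp_v (t - 1)
  have hshock : MemLp (fun ω => C.toEuclideanLin (w t ω) + (-K).toEuclideanLin (v (t - 1) ω)) 2 P :=
    (memLp_toEuclideanLin C hw).add (memLp_toEuclideanLin (-K) hv)
  rw [crossMoment_add_right hshock (memLp_toEuclideanLin C hw) (memLp_toEuclideanLin (-K) hv),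
    h.crossMoment_observerShock (memLp_toEuclideanLin C hw),
    h.crossMoment_observerShock (memLp_toEuclideanLin (-K) hv),
    crossMoment_toEuclideanLin_right C hw hw, crossMoment_toEuclideanLin_right C hv hw,
    crossMoment_toEuclideanLin_right (-K) hw hv, crossMoment_toEuclideanLin_right (-K) hv hv,
    h.crossMoment_w_self, h.crossMoment_v_self hR, h.crossMoment_w_v,
    crossMoment_eq_zero_comm.1 (h.crossMoment_w_v t (t - 1))]
  simp [Matrix.mul_assoc]

theorem crossMoment_observerError_self (h : IsGaussianDFM P A C G R x w y v)
    (hF : IsStable (A - K * G)) (hR : R.PosSemidef) (hS : S = gainStep A C G R K S) (t : ℤ) :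
    crossMoment P (observerError A G K x y t) (observerError A G K x y t) = S := by
  have he := h.isBoundedAR_observerError hF
  have horth (s : ℤ) : crossMoment P
      (fun ω => C.toEuclideanLin (w s ω) + (-K).toEuclideanLin (v (s - 1) ω))
      (observerError A G K x y (s - 1)) = 0 := by
    rw [h.crossMoment_observerShock (he.bounded.memLp _),
      crossMoment_eq_zero_comm.1 (h.crossMoment_observerError_w hF (sub_one_lt s)),
      crossMoment_eq_zero_comm.1 (h.crossMoment_observerError_v hF le_rfl), Matrix.mul_zero,
      Matrix.mul_zero, sub_zero]
  refine he.crossMoment_eq he hF hF (fun s => crossMoment_eq_zero_comm.1 (horth s)) horth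
    (h.crossMoment_observerShock_self hR) ?_ t
  rwa [add_comm]

theorem crossMoment_observerError_x (h : IsGaussianDFM P A C G R x w y v) (hA : IsStable A)
    (hF : IsStable (A - K * G)) (hS : S = (A - K * G) * S * Aᵀ + C * Cᵀ) (t : ℤ) :
    crossMoment P (observerError A G K x y t) (x t) = S := by
  refine (h.isBoundedAR_observerError hF).crossMoment_eq h.isBoundedAR_x hF hA (fun s => ?_)
    (fun s => ?_) (fun s => ?_) hS t
  · rw [crossMoment_toEuclideanLin_right C (h.memLp_observerError hF _) (h.memLp_w s),
      h.crossMoment_observerError_w hF (sub_one_lt s), Matrix.zero_mul]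
  · rw [h.crossMoment_observerShock (h.memLp_x _),
      crossMoment_eq_zero_comm.1 (h.crossMoment_x_w hA (sub_one_lt s)),
      crossMoment_eq_zero_comm.1 (h.crossMoment_x_v hA _ _), Matrix.mul_zero, Matrix.mul_zero,
      sub_zero]
  · rw [h.crossMoment_observerShock (memLp_toEuclideanLin C (h.memLp_w s)),
      crossMoment_toEuclideanLin_right C (h.memLp_w s) (h.memLp_w s),
      crossMoment_toEuclideanLin_right C (h.memLp_v _) (h.memLp_w s), h.crossMoment_w_self,
      crossMoment_eq_zero_comm.1 (h.crossMoment_w_v s (s - 1)), Matrix.zero_mul, Matrix.mul_zero,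
      sub_zero, Matrix.one_mul]

-- One step after `s` this is the equation `(A - K G) S Gᵀ = K R`, which the error dynamics
-- propagate to all later times.
theorem crossMoment_observerError_y (h : IsGaussianDFM P A C G R x w y v) (hA : IsStable A)
    (hR : R.PosSemidef) (hK : IsSteadyStateGain A C G R K S) {s t : ℤ} (hst : s < t) :
    crossMoment P (observerError A G K x y t) (y s) = 0 := by
  have hstep (r : ℤ) (hr : s < r) : crossMoment P (observerError A G K x y r) (y s) =
      (A - K * G) * crossMoment P (observerError A G K x y (r - 1)) (y s)
        - K * crossMoment P (v (r - 1)) (v s) := by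
    rw [(h.isBoundedAR_observerError hK.isStable).crossMoment_left (h.memLp_y s),
      h.crossMoment_observerShock (h.memLp_y s), h.crossMoment_w_y hA hr, h.crossMoment_v_y hA,
      Matrix.mul_zero, zero_sub, ← sub_eq_add_neg]
  induction t, Int.add_one_le_of_lt hst using Int.leInduction with
  | base =>
    rw [hstep _ hst, add_sub_cancel_right, h.crossMoment_v_self hR,
      h.crossMoment_y_right (h.memLp_observerError hK.isStable s),
      h.crossMoment_observerError_x hA hK.isStable hK.cov_eq,
      h.crossMoment_observerError_v hK.isStable le_rfl, add_zero, ← Matrix.mul_assoc, hK.gain_eq,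
      sub_self]
  | succ r hr ih =>
    rw [hstep _ hst, add_sub_cancel_right, ih hr, h.crossMoment_v_v (Int.lt_of_add_one_le hr).ne',
      Matrix.mul_zero, Matrix.mul_zero, sub_zero]

end IsGaussianDFM

namespace IsGaussianSpace

variable {Ω : Type*} [MeasurableSpace Ω] {P : Measure Ω} [IsProbabilityMeasure P] {m n : ℕ}
  {H : Submodule ℝ (Lp ℝ 2 P)}

theorem condExp_past_eq (hH : IsGaussianSpace H) {z p a : Ω → EuclideanSpace ℝ (Fin n)}
    {y : ℤ → Ω → EuclideanSpace ℝ (Fin m)} {t : ℤ} (hym : ∀ s, Measurable (y s))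
    (hy : ∀ s, CoordsMem H (y s)) (hz : z =ᵐ[P] p + a) (hp : Measurable[past y t] p)
    (hp₂ : MemLp p 2 P) (ha : CoordsMem H a) (h : ∀ s < t, crossMoment P a (y s) = 0) :
    P[z | past y t] =ᵐ[P] p := by
  have hp_eq : P[p | past y t] = p := condExp_of_stronglyMeasurable (past_le hym t)
    hp.stronglyMeasurable (hp₂.integrable one_le_two)
  filter_upwards [condExp_congr_ae (m := past y t) hz, hH.condExp_past_eq_zero hym ha hy h,
    condExp_add (m := past y t) (hp₂.integrable one_le_two) (ha.memLp.integrable one_le_two)]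
    with ω hzω haω hadd
  rw [hzω, hadd, Pi.add_apply, haω, hp_eq, Pi.zero_apply, add_zero]

end IsGaussianSpace

namespace IsGaussianDFM

variable {Ω : Type*} [MeasurableSpace Ω] {P : Measure Ω} {N M : ℕ}
  {A C : Matrix (Fin N) (Fin N) ℝ} {G : Matrix (Fin M) (Fin N) ℝ} {R : Matrix (Fin M) (Fin M) ℝ}
  {K : Matrix (Fin N) (Fin M) ℝ} {S : Matrix (Fin N) (Fin N) ℝ}
  {x w : ℤ → Ω → EuclideanSpace ℝ (Fin N)} {y v : ℤ → Ω → EuclideanSpace ℝ (Fin M)}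

theorem exists_isGaussianSpace_observerError (h : IsGaussianDFM P A C G R x w y v)
    (hA : IsStable A) (hF : IsStable (A - K * G)) :
    ∃ H : Submodule ℝ (Lp ℝ 2 P), IsGaussianSpace H ∧ (∀ t, CoordsMem H (y t)) ∧
      (∀ t, CoordsMem H (v t)) ∧ ∀ t, CoordsMem H (observerError A G K x y t) := by
  obtain ⟨H, hH, hw, hv, hy⟩ := h.exists_isGaussianSpace hA
  exact ⟨H, hH, hy, hv, (h.isBoundedAR_observerError hF).coordsMem hF hH.isClosed fun t =>
    ((hw t).toEuclideanLin C).add ((hv (t - 1)).toEuclideanLin (-K))⟩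

theorem condExp_x (h : IsGaussianDFM P A C G R x w y v) (hA : IsStable A) (hR : R.PosSemidef)
    (hK : IsSteadyStateGain A C G R K S) (t : ℤ) :
    P[x t | past y t] =ᵐ[P] observer A G K y t := by
  have := h.isProbabilityMeasure
  obtain ⟨H, hH, hy, -, he⟩ := h.exists_isGaussianSpace_observerError hA hK.isStable
  exact hH.condExp_past_eq h.measurable_y hy (.of_forall fun ω => (add_sub_cancel _ _).symm)
    (measurable_observer_past y t) ((h.isBoundedAR_observer hK.isStable).bounded.memLp t) (he t)
    fun s hs => h.crossMoment_observerError_y hA hR hK hs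

theorem predError_x (h : IsGaussianDFM P A C G R x w y v) (hA : IsStable A) (hR : R.PosSemidef)
    (hK : IsSteadyStateGain A C G R K S) (t : ℤ) :
    predError P x y t =ᵐ[P] observerError A G K x y t :=
  EventuallyEq.rfl.sub (h.condExp_x hA hR hK t)

theorem memLp_predError_x (h : IsGaussianDFM P A C G R x w y v) (hA : IsStable A)
    (hR : R.PosSemidef) (hK : IsSteadyStateGain A C G R K S) (t : ℤ) :
    MemLp (predError P x y t) 2 P :=
  (memLp_congr_ae (h.predError_x hA hR hK t)).2 (h.memLp_observerError hK.isStable t)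

theorem crossMoment_predError_x (h : IsGaussianDFM P A C G R x w y v) (hA : IsStable A)
    (hR : R.PosSemidef) (hK : IsSteadyStateGain A C G R K S) (t : ℤ) :
    crossMoment P (predError P x y t) (predError P x y t) = S := by
  have he := h.predError_x hA hR hK t
  rw [crossMoment_congr he he]
  exact h.crossMoment_observerError_self hK.isStable hR hK.eq_gainStep t

theorem crossMoment_innovation_y (h : IsGaussianDFM P A C G R x w y v) (hA : IsStable A)
    (hR : R.PosSemidef) (hK : IsSteadyStateGain A C G R K S) {s t : ℤ} (hst : s < t) :
    crossMoment P (fun ω => G.toEuclideanLin (observerError A G K x y t ω) + v t ω) (y s) = 0 := by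
  have he := h.memLp_observerError hK.isStable t
  rw [crossMoment_add_left (memLp_toEuclideanLin G he) (h.memLp_v t) (h.memLp_y s),
    crossMoment_toEuclideanLin_left G he (h.memLp_y s), h.crossMoment_observerError_y hA hR hK hst,
    h.crossMoment_v_y hA, h.crossMoment_v_v hst.ne', Matrix.mul_zero, add_zero]

theorem condExp_y (h : IsGaussianDFM P A C G R x w y v) (hA : IsStable A) (hR : R.PosSemidef)
    (hK : IsSteadyStateGain A C G R K S) (t : ℤ) :
    P[y t | past y t] =ᵐ[P] fun ω => G.toEuclideanLin (observer A G K y t ω) := by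
  have := h.isProbabilityMeasure
  obtain ⟨H, hH, hy, hv, he⟩ := h.exists_isGaussianSpace_observerError hA hK.isStable
  refine hH.condExp_past_eq h.measurable_y hy ?_
    ((LinearMap.continuous_of_finiteDimensional _).measurable.comp (measurable_observer_past y t))
    (memLp_toEuclideanLin G ((h.isBoundedAR_observer hK.isStable).bounded.memLp t))
    (((he t).toEuclideanLin G).add (hv t)) fun s hs => h.crossMoment_innovation_y hA hR hK hs
  filter_upwards [h.obs_eq t] with ω hω
  rw [hω, Pi.add_apply, ← add_assoc, ← map_add, observerError, add_sub_cancel]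

theorem predError_y (h : IsGaussianDFM P A C G R x w y v) (hA : IsStable A) (hR : R.PosSemidef)
    (hK : IsSteadyStateGain A C G R K S) (t : ℤ) :
    predError P y y t =ᵐ[P] fun ω => G.toEuclideanLin (observerError A G K x y t ω) + v t ω := by
  filter_upwards [h.condExp_y hA hR hK t, h.obs_eq t] with ω hcond hobs
  rw [predError, Pi.sub_apply, hcond, hobs, observerError, map_sub, add_sub_right_comm]

theorem memLp_predError_y (h : IsGaussianDFM P A C G R x w y v) (hA : IsStable A)
    (hR : R.PosSemidef) (hK : IsSteadyStateGain A C G R K S) (t : ℤ) :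
    MemLp (predError P y y t) 2 P :=
  (memLp_congr_ae (h.predError_y hA hR hK t)).2
    ((memLp_toEuclideanLin G (h.memLp_observerError hK.isStable t)).add (h.memLp_v t))

theorem hasSum_var (h : IsGaussianDFM P A C G R x w y v) (hA : IsStable A) (hR : R.PosSemidef)
    (hK : IsSteadyStateGain A C G R K S) (t : ℤ) :
    ∀ᵐ ω ∂P, HasSum
      (fun j : ℕ => (G * (A - K * G) ^ j * K).toEuclideanLin (y (t - ((j : ℤ) + 1)) ω))
      (y t ω - predError P y y t ω) := by
  filter_upwards [ae_summable_stationarySolution hK.isStable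
    ((h.isL2Bounded_y.comp fun t => t - 1).toEuclideanLin K) t, h.condExp_y hA hR hK t]
    with ω hsum hcond
  rw [predError, Pi.sub_apply, sub_sub_cancel, hcond]
  have hG : HasSum _ (G.toEuclideanLin (observer A G K y t ω)) :=
    hsum.hasSum.mapL (LinearMap.toContinuousLinearMap G.toEuclideanLin)
  convert hG using 2 with j
  rw [LinearMap.coe_toContinuousLinearMap', Matrix.toLpLin_mul_same, Matrix.toLpLin_mul_same,
    LinearMap.comp_apply, LinearMap.comp_apply, sub_sub]

theorem crossMoment_predError_y_past (h : IsGaussianDFM P A C G R x w y v) (hA : IsStable A)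
    (hR : R.PosSemidef) (hK : IsSteadyStateGain A C G R K S) {s t : ℤ} (hst : s < t) :
    crossMoment P (predError P y y t) (y s) = 0 := by
  rw [crossMoment_congr (h.predError_y hA hR hK t) .rfl]
  exact h.crossMoment_innovation_y hA hR hK hst

theorem crossMoment_predError_y (h : IsGaussianDFM P A C G R x w y v) (hA : IsStable A)
    (hR : R.PosSemidef) (hK : IsSteadyStateGain A C G R K S) (t : ℤ) :
    crossMoment P (predError P y y t) (predError P y y t) = innovCov G R S := by
  have ha := h.predError_y hA hR hK t
  have he := h.memLp_observerError hK.isStable t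
  have hGe := memLp_toEuclideanLin G he
  have hv := h.memLp_v t
  have hev := h.crossMoment_observerError_v hK.isStable (le_refl t)
  have hη : MemLp (fun ω => G.toEuclideanLin (observerError A G K x y t ω) + v t ω) 2 P :=
    hGe.add hv
  rw [crossMoment_congr ha ha, crossMoment_add_left hGe hv hη,
    crossMoment_add_right hGe hGe hv, crossMoment_add_right hv hGe hv,
    crossMoment_toEuclideanLin_left G he hGe, crossMoment_toEuclideanLin_left G he hv,
    crossMoment_toEuclideanLin_right G he he, crossMoment_toEuclideanLin_right G hv he,
    h.crossMoment_observerError_self hK.isStable hR hK.eq_gainStep, hev,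
    crossMoment_eq_zero_comm.1 hev, h.crossMoment_v_self hR, Matrix.mul_zero, add_zero,
    Matrix.zero_mul, zero_add, ← Matrix.mul_assoc, innovCov]

theorem eLpNorm_observer_le (h : IsGaussianDFM P A C G R x w y v) (hA : IsStable A)
    (hR : R.PosSemidef) (hK : IsSteadyStateGain A C G R K S) (t : ℤ) :
    eLpNorm (observer A G K y t) 2 P ≤ eLpNorm (x t) 2 P := by
  rw [← eLpNorm_congr_ae (h.condExp_x hA hR hK t)]
  exact eLpNorm_condExp_le_eLpNorm _ one_le_two

theorem sub_firstOrder_eq (h : IsGaussianDFM P A C G R x w y v) (hA : IsStable A)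
    (hR : R.PosSemidef) (hK : IsSteadyStateGain A C G R K S) (t : ℤ) :
    (fun ω => y t ω - ((G * K).toEuclideanLin (y (t - 1) ω) + predError P y y t ω)) =ᵐ[P]
      fun ω => (G * (A - K * G)).toEuclideanLin (observer A G K y (t - 1) ω) := by
  filter_upwards [h.condExp_y hA hR hK t, (h.isBoundedAR_observer hK.isStable).eq t]
    with ω hcond hstep
  rw [predError, Pi.sub_apply, hcond, hstep, Matrix.toLpLin_mul_same, Matrix.toLpLin_mul_same,
    LinearMap.comp_apply, LinearMap.comp_apply, map_add]
  abel

theorem eLpNorm_sub_firstOrder_le (h : IsGaussianDFM P A C G R x w y v) (hA : IsStable A)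
    (hR : R.PosSemidef) (hK : IsSteadyStateGain A C G R K S) {U : Matrix (Fin N) (Fin N) ℝ}
    (hU : U = A * U * Aᵀ + C * Cᵀ) (t : ℤ) :
    eLpNorm (fun ω => y t ω - ((G * K).toEuclideanLin (y (t - 1) ω) + predError P y y t ω)) 2 P ≤
      ENNReal.ofReal (‖G‖ * ‖A - K * G‖ * √U.trace) := by
  have hx : eLpNorm (x (t - 1)) 2 P = ENNReal.ofReal √U.trace := by
    rw [eLpNorm_eq_sqrt_trace_crossMoment (h.memLp_x _), h.crossMoment_x_self hA hU]
  calc _ = eLpNorm (fun ω => (G * (A - K * G)).toEuclideanLin (observer A G K y (t - 1) ω)) 2 P :=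
        eLpNorm_congr_ae (h.sub_firstOrder_eq hA hR hK t)
    _ ≤ ENNReal.ofReal ‖G * (A - K * G)‖ * eLpNorm (observer A G K y (t - 1)) 2 P :=
        eLpNorm_toEuclideanLin_le _ _
    _ ≤ ENNReal.ofReal (‖G‖ * ‖A - K * G‖) * ENNReal.ofReal √U.trace := by
        gcongr
        · exact Matrix.frobenius_norm_mul _ _
        · exact (h.eLpNorm_observer_le hA hR hK _).trans_eq hx
    _ = _ := (ENNReal.ofReal_mul (by positivity)).symm

end IsGaussianDFM

theorem tendsto_eLpNorm_sub_firstOrder {N : ℕ} {A C : Matrix (Fin N) (Fin N) ℝ} {d : ℕ → ℕ}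
    {G : (M : ℕ) → Matrix (Fin (d M)) (Fin N) ℝ} {R : (M : ℕ) → Matrix (Fin (d M)) (Fin (d M)) ℝ}
    {K : (M : ℕ) → Matrix (Fin N) (Fin (d M)) ℝ} {S : ℕ → Matrix (Fin N) (Fin N) ℝ}
    {Ω : ℕ → Type*} [∀ M, MeasurableSpace (Ω M)] {P : (M : ℕ) → Measure (Ω M)}
    {x w : (M : ℕ) → ℤ → Ω M → EuclideanSpace ℝ (Fin N)}
    {y v : (M : ℕ) → ℤ → Ω M → EuclideanSpace ℝ (Fin (d M))}
    (h : ∀ M, IsGaussianDFM (P M) A C (G M) (R M) (x M) (w M) (y M) (v M)) (hA : IsStable A)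
    (hR : ∀ M, (R M).PosSemidef) (hK : ∀ M, IsSteadyStateGain A C (G M) (R M) (K M) (S M))
    (hlim : Tendsto (fun M => ‖G M‖ * ‖A - K M * G M‖) atTop (𝓝 0)) (t : ℤ) :
    Tendsto (fun M => eLpNorm (fun ω => y M t ω -
      ((G M * K M).toEuclideanLin (y M (t - 1) ω) + predError (P M) (y M) (y M) t ω)) 2 (P M))
      atTop (𝓝 0) := by
  obtain ⟨U, -, hU⟩ := hA.exists_lyapunov (Matrix.posSemidef_self_mul_conjTranspose C)
  have hbound := ENNReal.tendsto_ofReal (hlim.mul_const √U.trace)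
  rw [zero_mul, ENNReal.ofReal_zero] at hbound
  exact tendsto_of_tendsto_of_tendsto_of_le_of_le tendsto_const_nhds hbound (fun _ => zero_le)
    fun M => (h M).eLpNorm_sub_firstOrder_le hA (hR M) (hK M) hU t

end DFM

theorem mainTheorem1 {N : ℕ}
    -- the parameters: `A`, `C`, `σ` do not depend on the number `M` of observables
    (A C : Matrix (Fin N) (Fin N) ℝ) (G : (M : ℕ) → Matrix (Fin M) (Fin N) ℝ) (σ : ℝ)
    (hA_stable : DFM.IsStable A) (hA : A.rank = N) (hC : IsUnit C) (hσ : 0 < σ)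
    (hG : ∀ᶠ M in atTop, (G M).rank = N)
    -- `GᵀG` is of order `M`: all its eigenvalues are bounded above and below by multiples of `M`
    (hG_upper : (fun M : ℕ => ‖(G M)ᵀ * G M‖) =O[atTop] fun M : ℕ => (M : ℝ))
    (hG_lower : (fun M : ℕ => ‖((G M)ᵀ * G M)⁻¹‖) =O[atTop] fun M : ℕ => (M : ℝ)⁻¹)
    -- for each `M`, a dynamic factor model with measurement error covariance `σ² I`
    {Ω : ℕ → Type*} [∀ M, MeasurableSpace (Ω M)] (P : (M : ℕ) → Measure (Ω M))
    [∀ M, IsProbabilityMeasure (P M)]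
    (x w : (M : ℕ) → ℤ → Ω M → EuclideanSpace ℝ (Fin N))
    (y v : (M : ℕ) → ℤ → Ω M → EuclideanSpace ℝ (Fin M))
    (hDFM : ∀ M, DFM.IsGaussianDFM (P M) A C (G M) (σ ^ 2 • 1) (x M) (w M) (y M) (v M)) :
    ∃ S : ℕ → Matrix (Fin N) (Fin N) ℝ,
      -- `S M` is the unique positive semidefinite solution of the Riccati equation, it is
      -- invertible, and it is the covariance of the prediction error of the state
      (∀ M, (S M).PosDef ∧ DFM.Riccati A C (G M) (σ ^ 2 • 1) (S M) ∧
        (∀ S' : Matrix (Fin N) (Fin N) ℝ, S'.PosSemidef →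
          DFM.Riccati A C (G M) (σ ^ 2 • 1) S' → S' = S M) ∧
        ∀ t, MemLp (DFM.predError (P M) (x M) (y M) t) 2 (P M) ∧
          DFM.crossMoment (P M) (DFM.predError (P M) (x M) (y M) t)
            (DFM.predError (P M) (x M) (y M) t) = S M) ∧
      -- the infinite-order VAR representation, with innovations `a_t = y_t - E[y_t ∣ y^{t-1}]`
      (∀ M t, MemLp (y M t) 2 (P M) ∧ MemLp (DFM.predError (P M) (y M) (y M) t) 2 (P M) ∧
        (∀ᵐ ω ∂(P M), HasSum
          (fun j : ℕ => (DFM.varCoeff A (G M) (σ ^ 2 • 1) (S M) (j + 1)).toEuclideanLin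
            (y M (t - ((j : ℤ) + 1)) ω))
          (y M t ω - DFM.predError (P M) (y M) (y M) t ω)) ∧
        (∀ j : ℕ, 1 ≤ j →
          DFM.crossMoment (P M) (DFM.predError (P M) (y M) (y M) t) (y M (t - (j : ℤ))) = 0) ∧
        DFM.crossMoment (P M) (DFM.predError (P M) (y M) (y M) t)
          (DFM.predError (P M) (y M) (y M) t) = DFM.innovCov (G M) (σ ^ 2 • 1) (S M)) ∧
      -- the coefficients of order at least two vanish, with a rate
      (∀ j : ℕ, 2 ≤ j →
        Tendsto (fun M => ‖DFM.varCoeff A (G M) (σ ^ 2 • 1) (S M) j‖) atTop (𝓝 0) ∧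
        limsup (fun M : ℕ =>
          (((M : ℝ) ^ (j - 1) * ‖DFM.varCoeff A (G M) (σ ^ 2 • 1) (S M) j‖ : ℝ) : EReal))
          atTop < ⊤) ∧
      -- the VAR collapses to the first-order VAR `y_t = G K y_{t-1} + a_t`, in mean square
      (∀ t : ℤ, Tendsto (fun M => eLpNorm (fun ω => y M t ω -
          ((G M * DFM.kalmanGain A (G M) (σ ^ 2 • 1) (S M)).toEuclideanLin (y M (t - 1) ω)
            + DFM.predError (P M) (y M) (y M) t ω)) 2 (P M)) atTop (𝓝 0)) ∧
      -- and the first coefficient is `G K`, of rank `N`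
      (∀ M, DFM.varCoeff A (G M) (σ ^ 2 • 1) (S M) 1 =
        G M * DFM.kalmanGain A (G M) (σ ^ 2 • 1) (S M)) ∧
      (∀ M, (G M).rank = N →
        (G M * DFM.kalmanGain A (G M) (σ ^ 2 • 1) (S M)).rank = N) := by
  have hσ₂ : 0 < σ ^ 2 := by positivity
  have hR (M : ℕ) : (σ ^ 2 • (1 : Matrix (Fin M) (Fin M) ℝ)).PosDef := DFM.posDef_smul_one hσ₂
  have hR' (M : ℕ) := (hR M).posSemidef
  choose S hS hRic using fun M => DFM.exists_riccati C (G M) hA_stable (hR M)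
  have hS' (M : ℕ) : (S M).PosDef := (hRic M).posDef (hR M) hC (hS M)
  have hK (M : ℕ) := (hRic M).isSteadyStateGain (hR M) hC (hS M)
  refine ⟨S, fun M => ⟨hS' M, hRic M, fun T hT hRicT => ?_, fun t => ⟨?_, ?_⟩⟩,
    fun M t => ⟨(hDFM M).memLp_y t, ?_, ?_, fun j hj => ?_, ?_⟩, fun j hj => ⟨?_, ?_⟩,
    fun t => ?_, fun M => ?_, fun M hM => ?_⟩
  · exact hRicT.unique (hRic M) (hR M) hC hT (hS M)
  · exact (hDFM M).memLp_predError_x hA_stable (hR' M) (hK M) t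
  · exact (hDFM M).crossMoment_predError_x hA_stable (hR' M) (hK M) t
  · exact (hDFM M).memLp_predError_y hA_stable (hR' M) (hK M) t
  · exact (hDFM M).hasSum_var hA_stable (hR' M) (hK M) t
  · exact (hDFM M).crossMoment_predError_y_past hA_stable (hR' M) (hK M) (by lia)
  · exact (hDFM M).crossMoment_predError_y hA_stable (hR' M) (hK M) t
  · exact DFM.tendsto_varCoeff hσ₂ hS hC hRic hG hG_upper hG_lower hj
  · exact DFM.limsup_varCoeff_lt_top hσ₂ hS hC hRic hG hG_upper hG_lower hj
  · exact DFM.tendsto_eLpNorm_sub_firstOrder hDFM hA_stable hR' hK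
      (DFM.tendsto_norm_mul_norm_closedLoop hσ₂ hS hC hRic hG hG_upper hG_lower) t
  · rw [DFM.varCoeff, Nat.sub_self, pow_zero, Matrix.mul_one]
  · exact DFM.rank_mul_kalmanGain (hR M) (hS' M) (Matrix.mulVec_injective_iff_isUnit.1
      (DFM.mulVec_injective_of_rank_eq hA)) hM
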